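/- Let $\alpha$ be a real quadratic number, that is, a real number of degree $2$ over $\mathbb{Q}$. Write $x^{\sigma}$ for the Galois conjugate of a real quadratic number $x$, let $PSL(2,\mathbb{Z})$ act on real irrational numbers by fractional linear transformations, and let $\Theta_\alpha = PSL(2,\mathbb{Z})\{\alpha,\alpha^{\sigma}\}$ be the union of the orbits of $\alpha$ and $\alpha^{\sigma}$. The quadratic Lagrange spectrum $Sp_\alpha$ of $\alpha$ is the set of the real values $$c_\alpha(\xi) = \liminf_{\beta\in\Theta_\alpha,\ |\beta-\beta^{\sigma}|\to 0} 2\,\frac{|\xi-\beta|}{|\beta-\beta^{\sigma}|},$$ where $\xi$ runs over all real numbers not in $\mathbb{Q}\cup\Theta_\alpha$. Let $b_1,\dots,b_s$ be the shortest period of the (eventually periodic) continued fraction expansion of $\alpha$, so that $s$ is its length, and put $B = 2+\max(b_1,\dots,b_s)$. Let $n$ be the minimal positive integer with $$2^{(n-1)s} > 16\cdot 16\cdot 36\cdot 144\, B^{2s+8},$$ and put $$\psi(\alpha) = \frac{1}{72\cdot 72\, B^{s(6n+6)+4}}.$$ Then $\psi(\alpha)>0$ and $[0,\psi(\alpha)]\subset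 Sp_\alpha$. -/

import Mathlib

open Filter Topology

noncomputable section

namespace QuadLagrange

/-- A real quadratic number: a real number of degree two over `ℚ`. -/
def IsRealQuadratic (x : ℝ) : Prop := (minpoly ℚ x).natDegree = 2

/-- The Galois conjugate `x^σ` of a real quadratic number `x`: the other root of its minimal
polynomial `X ^ 2 + b X + c`, namely `-b - x` (see `galConj_spec`). -/
def galConj (x : ℝ) : ℝ := -((minpoly ℚ x).coeff 1 : ℝ) - x

theorem galConj_spec {x : ℝ} (hx : IsRealQuadratic x) :
    galConj x ≠ x ∧ IsConjRoot ℚ x (galConj x) := by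
  have h2 : (minpoly ℚ x).natDegree = 2 := hx
  have hint : IsIntegral ℚ x := by
    by_contra h
    rw [minpoly.eq_zero h] at h2
    simp at h2
  have hmon := minpoly.monic hint
  have hc2 : (minpoly ℚ x).coeff 2 = 1 := by
    have := hmon.coeff_natDegree
    rwa [h2] at this
  have hae : ∀ y : ℝ, Polynomial.aeval y (minpoly ℚ x) =
      ((minpoly ℚ x).coeff 0 : ℝ) + ((minpoly ℚ x).coeff 1 : ℝ) * y + y ^ 2 := by
    intro y
    rw [Polynomial.aeval_eq_sum_range, h2]
    simp [Finset.sum_range_succ, Algebra.smul_def, hc2]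
  have hx0 := minpoly.aeval ℚ x
  rw [hae] at hx0
  refine ⟨fun h => ?_, ?_⟩
  · have hrat : x = algebraMap ℚ ℝ (-((minpoly ℚ x).coeff 1) / 2) := by
      unfold galConj at h
      simp only [eq_ratCast]
      push_cast
      linarith
    have := minpoly.eq_X_sub_C ℝ (-((minpoly ℚ x).coeff 1) / 2 : ℚ)
    rw [← hrat] at this
    rw [this, Polynomial.natDegree_X_sub_C] at h2
    omega
  · refine minpoly.eq_of_irreducible_of_monic (minpoly.irreducible hint) ?_ hmon
    rw [hae]
    unfold galConj
    linear_combination hx0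

/-- The action of an integral matrix of determinant one (hence of its class in `PSL(2, ℤ)`) by
the fractional linear transformation `x ↦ (a x + b) / (c x + d)`. It is only applied to irrational
numbers, where the denominator does not vanish. -/
def moebius (g : Matrix.SpecialLinearGroup (Fin 2) ℤ) (x : ℝ) : ℝ :=
  ((g.1 0 0 : ℝ) * x + (g.1 0 1 : ℝ)) / ((g.1 1 0 : ℝ) * x + (g.1 1 1 : ℝ))

/-- `Θ_α`, the union of the `PSL(2, ℤ)`-orbits of `α` and `α^σ`. -/
def Theta (α : ℝ) : Set ℝ :=
  {β | ∃ g : Matrix.SpecialLinearGroup (Fin 2) ℤ, β = moebius g α ∨ β = moebius g (galConj α)}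

/-- `c_α(ξ) = liminf 2 |ξ - β| / |β - β^σ|` over `β ∈ Θ_α` with `|β - β^σ| → 0`, taken in the
extended reals so that an infinite lower limit is not replaced by a real default value. -/
def approxConst (α ξ : ℝ) : EReal :=
  liminf (fun β : ℝ => ((2 * |ξ - β| / |β - galConj β| : ℝ) : EReal))
    (comap (fun β : ℝ => |β - galConj β|) (𝓝 0) ⊓ 𝓟 (Theta α))

/-- The quadratic Lagrange spectrum `Sp_α`. -/
def Sp (α : ℝ) : Set ℝ :=
  {c | ∃ ξ : ℝ, Irrational ξ ∧ ξ ∉ Theta α ∧ approxConst α ξ = (c : EReal)}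

/-- The `k`-th complete quotient in the continued fraction expansion of `x`: it starts with `x`,
and `t` is followed by `1 / (t - ⌊t⌋)`. -/
def completeQuot (x : ℝ) (k : ℕ) : ℝ := (fun t : ℝ => (Int.fract t)⁻¹)^[k] x

/-- The `k`-th partial quotient `a_k` of `x = [a_0, a_1, a_2, …]`. -/
def partialQuot (x : ℝ) (k : ℕ) : ℤ := ⌊completeQuot x k⌋

/-- The partial quotients of `x` are periodic with period `s` from index `N` on. -/
def PeriodicFrom (x : ℝ) (N s : ℕ) : Prop :=
  ∀ k, N ≤ k → partialQuot x (k + s) = partialQuot x k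

/-- The length `s` of the shortest period of the continued fraction expansion of `x`. -/
def periodLength (x : ℝ) : ℕ := sInf {s | 0 < s ∧ ∃ N, PeriodicFrom x N s}

/-- The length of the preperiod of the continued fraction expansion of `x`. -/
def preperiodLength (x : ℝ) : ℕ := sInf {N | PeriodicFrom x N (periodLength x)}

/-- `B = 2 + max (b_1, …, b_s)`, where `b_1, …, b_s` is the period of `x`. -/
def periodBound (x : ℝ) : ℕ :=
  2 + (Finset.range (periodLength x)).sup
    (fun i => (partialQuot x (preperiodLength x + i)).toNat)

/-- The minimal positive integer `n` such that
`2 ^ ((n - 1) s) > 16 * 16 * 36 * 144 * B ^ (2 s + 8)`. -/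
def minExp (s B : ℕ) : ℕ :=
  sInf {n | 0 < n ∧ 16 * 16 * 36 * 144 * B ^ (2 * s + 8) < 2 ^ ((n - 1) * s)}

/-- `ψ(α) = 1 / (72 * 72 * B ^ (s (6 n + 6) + 4))`. -/
def psi (α : ℝ) : ℝ :=
  1 / (72 * 72 * (periodBound α : ℝ) ^
    (periodLength α * (6 * minExp (periodLength α) (periodBound α) + 6) + 4))

end QuadLagrange

/-!
The conjugate pairs in `Θ_α` are the roots of integral binary quadratic forms of one and the same
discriminant `w²`. Integrality forces `|β - β^σ| |γ - γ^σ| ≤ 2 w² |β - γ| |β^σ - γ^σ|` for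
distinct `β, γ`, so the elements of `Θ_α` with `|β - β^σ|` of a given size are sparse, and numbers
that avoid good approximations at all scales are found in a Cantor-like construction.

Let `α` maximize `|α - α^σ|`, and let `x, y` move along two curves that keep the cross ratio of
`x, y, α, α^σ` equal to a prescribed small `c`; for some parameter both `x` and `y` are badly
approximable by `Θ_α`. Replacing them by rational numbers and sending `y` to infinity by an element
of `SL(2, ℤ)` turns `x` into a rational number whose approximation ratios are at least about `c`,
with `c` nearly attained. Integral translations and another such element bring this rational number
close to any given one, and the value `c` is then nearly attained at pairs of arbitrarily small gap.
The limit of a rapidly converging sequence of such rational numbers has approximation constant `c`.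
This gives `[0, 1 / (10⁷ w⁵)] ⊆ Sp_α`, and multiplying out the period of the continued fraction of
`α` gives `w² ≤ B ^ (2 s + 2)`, whence `ψ(α) ≤ 1 / (10⁷ w⁵)`.
-/

noncomputable section

namespace QuadLagrange

/-! ### Conjugate pairs and their discriminant -/

theorem one_le_abs_intCast {m : ℤ} (hm : (m : ℝ) ≠ 0) : 1 ≤ |(m : ℝ)| := by
  exact_mod_cast Int.one_le_abs (Int.cast_ne_zero.1 hm)

section ConjPair

variable {w x y : ℝ}

/-- `x` and `y` are the two roots of a binary quadratic form with integral coefficients `a, -b, c`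
and positive discriminant `w ^ 2`; the sign of `a` is chosen so that `a (x - y) = w`. The common
discriminant is the only trace of `α` that the estimates on its orbit use. -/
structure ConjPair (w x y : ℝ) : Prop where
  pos : 0 < w
  exists_form : ∃ a b c : ℤ, (a : ℝ) * (x - y) = w ∧ (a : ℝ) * (x + y) = b ∧ (a : ℝ) * (x * y) = c

namespace ConjPair

variable {x₁ y₁ x₂ y₂ : ℝ}

theorem symm (h : ConjPair w x y) : ConjPair w y x := by
  obtain ⟨hw, a, b, c, hab, hb, hc⟩ := h
  refine ⟨hw, -a, -b, -c, ?_, ?_, ?_⟩ <;> push_cast <;> linarith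

theorem ne (h : ConjPair w x y) : x ≠ y := by
  obtain ⟨hw, a, b, c, hab, -⟩ := h
  rintro rfl
  simp [hw.ne] at hab

theorem exists_abs_mul_eq (h : ConjPair w x y) : ∃ a b c : ℤ, 0 < |(a : ℝ)| ∧
    |(a : ℝ)| * |x - y| = w ∧ (a : ℝ) * (x + y) = b ∧ (a : ℝ) * (x * y) = c := by
  obtain ⟨hw, a, b, c, hab, hb, hc⟩ := h
  have ha : (a : ℝ) ≠ 0 := left_ne_zero_of_mul (hab ▸ hw.ne')
  exact ⟨a, b, c, abs_pos.2 ha, by rw [← abs_mul, hab, abs_of_pos hw], hb, hc⟩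

theorem separation (h₁ : ConjPair w x₁ y₁) (h₂ : ConjPair w x₂ y₂)
    (hx : x₁ ≠ x₂) (hy : y₁ ≠ y₂) :
    |x₁ - y₁| * |x₂ - y₂| ≤ 2 * w ^ 2 * (|x₁ - x₂| * |y₁ - y₂|) := by
  obtain ⟨hw, a, b, c, h1, h2, h3⟩ := h₁
  obtain ⟨-, a', b', c', h1', h2', h3'⟩ := h₂
  have ha : (a : ℝ) ≠ 0 := left_ne_zero_of_mul (h1 ▸ hw.ne')
  have ha' : (a' : ℝ) ≠ 0 := left_ne_zero_of_mul (h1' ▸ hw.ne')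
  -- `w ^ 2` minus the polarized discriminant of the two forms is an integer, and it factors.
  have key : ((2 * a' * c + 2 * a * c' - b * b' + (b ^ 2 - 4 * a * c) : ℤ) : ℝ) =
      2 * a * a' * ((x₁ - x₂) * (y₁ - y₂)) := by
    have hdisc : (b : ℝ) ^ 2 - 4 * a * c = (a * (x₁ - y₁)) * (a' * (x₂ - y₂)) := by
      rw [h1, h1', ← h2, ← h3, ← h1]; ring
    push_cast
    rw [hdisc, ← h2, ← h3, ← h2', ← h3']; ring
  have hone : 1 ≤ 2 * |(a : ℝ)| * |(a' : ℝ)| * (|x₁ - x₂| * |y₁ - y₂|) := by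
    have := sub_ne_zero.2 hx
    have := sub_ne_zero.2 hy
    have h := one_le_abs_intCast (by rw [key]; positivity)
    simpa only [key, abs_mul, abs_two] using h
  calc |x₁ - y₁| * |x₂ - y₂|
      ≤ |x₁ - y₁| * |x₂ - y₂| * (2 * |(a : ℝ)| * |(a' : ℝ)| * (|x₁ - x₂| * |y₁ - y₂|)) :=
        le_mul_of_one_le_right (by positivity) hone
    _ = 2 * |a * (x₁ - y₁)| * |a' * (x₂ - y₂)| * (|x₁ - x₂| * |y₁ - y₂|) := by
        rw [abs_mul, abs_mul]; ring
    _ = 2 * w ^ 2 * (|x₁ - x₂| * |y₁ - y₂|) := by rw [h1, h1', abs_of_pos hw]; ring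

theorem abs_sub_le_of_rat (h : ConjPair w x y) (z : ℚ) (hx : (z : ℝ) ≠ x) (hy : (z : ℝ) ≠ y) :
    |x - y| ≤ w * z.den ^ 2 * (|z - x| * |z - y|) := by
  obtain ⟨a, b, c, ha, hab, hb, hc⟩ := h.exists_abs_mul_eq
  have key : ((a * z.num ^ 2 - b * z.num * z.den + c * z.den ^ 2 : ℤ) : ℝ) =
      a * z.den ^ 2 * ((z - x) * (z - y)) := by
    have hz : (z : ℝ) * z.den = z.num := by exact_mod_cast Rat.mul_den_eq_num z
    push_cast
    rw [← hb, ← hc, ← hz]; ring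
  have hone : 1 ≤ |(a : ℝ)| * z.den ^ 2 * (|z - x| * |z - y|) := by
    have ha' : (a : ℝ) ≠ 0 := abs_pos.1 ha
    have := sub_ne_zero.2 hx
    have := sub_ne_zero.2 hy
    have : (z.den : ℝ) ≠ 0 := by exact_mod_cast z.den_ne_zero
    have h := one_le_abs_intCast (by rw [key]; positivity)
    simpa only [key, abs_mul, abs_pow, Nat.abs_cast] using h
  calc |x - y| ≤ |x - y| * (|(a : ℝ)| * z.den ^ 2 * (|z - x| * |z - y|)) :=
        le_mul_of_one_le_right (by positivity) hone
    _ = (|(a : ℝ)| * |x - y|) * z.den ^ 2 * (|z - x| * |z - y|) := by ring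
    _ = w * z.den ^ 2 * (|z - x| * |z - y|) := by rw [hab]

theorem one_le (h : ConjPair w x y) : 1 ≤ w := by
  obtain ⟨hw, a, b, c, h1, h2, h3⟩ := h
  have hdisc : ((b ^ 2 - 4 * a * c : ℤ) : ℝ) = w ^ 2 := by
    push_cast
    rw [← h1, ← h2]
    linear_combination 4 * (a : ℝ) * h3
  have hone := one_le_abs_intCast (by rw [hdisc]; positivity)
  rw [hdisc, abs_pow, one_le_sq_iff_one_le_abs, abs_abs, abs_of_pos hw] at hone
  exact hone

theorem abs_sub_le (h : ConjPair w x y) : |x - y| ≤ w := by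
  obtain ⟨a, -, -, ha, hab, -⟩ := h.exists_abs_mul_eq
  rw [← hab]
  exact le_mul_of_one_le_left (abs_nonneg _) (one_le_abs_intCast (abs_pos.1 ha))

theorem add_int (h : ConjPair w x y) (n : ℤ) : ConjPair w (n + x) (n + y) := by
  obtain ⟨hw, a, b, c, h1, h2, h3⟩ := h
  refine ⟨hw, a, 2 * a * n + b, a * n ^ 2 + b * n + c, ?_, ?_, ?_⟩
  · linear_combination h1
  · push_cast; linear_combination h2
  · push_cast; linear_combination h3 + n * h2

theorem inv (h : ConjPair w x y) (hx : x ≠ 0) (hy : y ≠ 0) : ConjPair w x⁻¹ y⁻¹ := by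
  obtain ⟨hw, a, b, c, h1, h2, h3⟩ := h
  refine ⟨hw, -c, -b, -a, ?_, ?_, ?_⟩
  · push_cast; rw [← h3, ← h1]; field_simp; ring
  · push_cast; rw [← h3, ← h2]; field_simp; ring
  · push_cast; rw [← h3]; field_simp

theorem exists_rat (h : ConjPair w x y) : ∃ s p : ℚ, x + y = s ∧ x * y = p := by
  obtain ⟨hw, a, b, c, h1, h2, h3⟩ := h
  have ha : (a : ℝ) ≠ 0 := left_ne_zero_of_mul (h1 ▸ hw.ne')
  refine ⟨b / a, c / a, ?_, ?_⟩
  · push_cast; rw [← h2]; field_simp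
  · push_cast; rw [← h3]; field_simp

theorem irrational_right (h : ConjPair w x y) (hx : Irrational x) : Irrational y := by
  obtain ⟨s, -, hs, -⟩ := h.exists_rat
  rw [← eq_sub_iff_add_eq'] at hs
  exact hs ▸ hx.ratCast_sub s

end ConjPair

/-! ### The Galois conjugate -/

theorem IsRealQuadratic.isIntegral (hx : IsRealQuadratic x) : IsIntegral ℚ x := by
  by_contra h
  have h2 : (minpoly ℚ x).natDegree = 2 := hx
  simp [minpoly.eq_zero h] at h2

theorem two_le_natDegree_minpoly (hx : Irrational x) (hint : IsIntegral ℚ x) :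
    2 ≤ (minpoly ℚ x).natDegree := by
  rw [minpoly.two_le_natDegree_iff hint]
  rintro ⟨q, hq⟩
  exact hx ⟨q, by simpa using hq⟩

theorem IsRealQuadratic.irrational (hx : IsRealQuadratic x) : Irrational x := by
  have h := (minpoly.two_le_natDegree_iff hx.isIntegral).1 (le_of_eq (Eq.symm hx))
  rintro ⟨q, hq⟩
  exact h ⟨q, by simpa using hq⟩

open Polynomial in
theorem minpoly_eq_of_add_of_mul (hx : Irrational x) {s p : ℚ} (hs : x + y = s)
    (hp : x * y = p) : minpoly ℚ x = X ^ 2 - C s * X + C p := by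
  have hdeg : (X ^ 2 - C s * X + C p : ℚ[X]).natDegree = 2 := by compute_degree!
  have hmon : (X ^ 2 - C s * X + C p : ℚ[X]).Monic := by monicity!
  have hroot : aeval x (X ^ 2 - C s * X + C p : ℚ[X]) = 0 := by
    simp only [map_add, map_sub, map_mul, map_pow, aeval_X, aeval_C, eq_ratCast]
    rw [← hs, ← hp]; ring
  have hint : IsIntegral ℚ x := ⟨_, hmon, hroot⟩
  exact (eq_of_monic_of_dvd_of_natDegree_le (minpoly.monic hint) hmon (minpoly.dvd ℚ x hroot)
    (hdeg.trans_le (two_le_natDegree_minpoly hx hint))).symm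

theorem galConj_eq_of_add_of_mul (hx : Irrational x) {s p : ℚ} (hs : x + y = s)
    (hp : x * y = p) : galConj x = y := by
  simp [galConj, minpoly_eq_of_add_of_mul hx hs hp, Polynomial.coeff_C, ← hs]

theorem ConjPair.galConj_eq (h : ConjPair w x y) (hx : Irrational x) : galConj x = y := by
  obtain ⟨s, p, hs, hp⟩ := h.exists_rat
  exact galConj_eq_of_add_of_mul hx hs hp

theorem IsRealQuadratic.exists_quadratic_eq_zero (hx : IsRealQuadratic x) :
    ∃ s p : ℚ, x ^ 2 - s * x + p = 0 := by
  have h2 : (minpoly ℚ x).natDegree = 2 := hx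
  have hc2 : (minpoly ℚ x).coeff 2 = 1 := h2 ▸ (minpoly.monic hx.isIntegral).coeff_natDegree
  refine ⟨-(minpoly ℚ x).coeff 1, (minpoly ℚ x).coeff 0, ?_⟩
  have hroot := minpoly.aeval ℚ x
  rw [Polynomial.aeval_eq_sum_range, h2] at hroot
  simp only [Finset.sum_range_succ, Finset.sum_range_zero, Algebra.smul_def, hc2, eq_ratCast]
    at hroot
  push_cast at hroot ⊢
  linear_combination hroot

theorem ConjPair.of_root (hx : Irrational x) {a b c : ℤ} (ha : a ≠ 0)
    (hroot : (a : ℝ) * x ^ 2 - b * x + c = 0) :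
    ConjPair (√((b : ℝ) ^ 2 - 4 * a * c)) x (galConj x) := by
  have ha' : (a : ℝ) ≠ 0 := Int.cast_ne_zero.2 ha
  have hgal : galConj x = b / a - x := by
    refine galConj_eq_of_add_of_mul hx (s := b / a) (p := c / a) ?_ ?_
    · push_cast; ring
    · push_cast; field_simp; linear_combination -hroot
  have hdisc : (b : ℝ) ^ 2 - 4 * a * c = (2 * a * x - b) ^ 2 := by
    linear_combination -4 * (a : ℝ) * hroot
  have hne : 2 * a * x - b ≠ 0 := fun h ↦ hx ⟨b / (2 * a), by push_cast; field_simp; linarith⟩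
  rw [hdisc, Real.sqrt_sq_eq_abs, hgal]
  refine ⟨abs_pos.2 hne, ?_⟩
  rcases abs_choice (2 * (a : ℝ) * x - b) with h | h <;> rw [h]
  · refine ⟨a, b, c, ?_, ?_, ?_⟩
    · field_simp; ring
    · field_simp; ring
    · field_simp; linear_combination -hroot
  · refine ⟨-a, -b, -c, ?_, ?_, ?_⟩
    · push_cast; field_simp; ring
    · push_cast; field_simp; ring
    · push_cast; field_simp; linear_combination hroot

theorem IsRealQuadratic.exists_conjPair (hx : IsRealQuadratic x) :
    ∃ w, ConjPair w x (galConj x) := by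
  obtain ⟨s, p, hsp⟩ := hx.exists_quadratic_eq_zero
  have hs : (s : ℝ) * s.den = s.num := by exact_mod_cast Rat.mul_den_eq_num s
  have hp : (p : ℝ) * p.den = p.num := by exact_mod_cast Rat.mul_den_eq_num p
  refine ⟨_, ConjPair.of_root hx.irrational (a := s.den * p.den) (b := s.num * p.den)
    (c := p.num * s.den) (by exact_mod_cast mul_ne_zero s.den_ne_zero p.den_ne_zero) ?_⟩
  push_cast
  rw [← hs, ← hp]
  linear_combination (s.den : ℝ) * p.den * hsp

end ConjPair

/-! ### The modular group -/

open scoped MatrixGroups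

section Moebius

variable {w x y z : ℝ} (g : SL(2, ℤ))

/-- The denominator `c x + d` of the fractional linear transformation `moebius g`; its zero is the
pole of `moebius g`. -/
def denom (x : ℝ) : ℝ := (g.1 1 0 : ℝ) * x + g.1 1 1

theorem det_eq_one : (g.1 0 0 : ℝ) * g.1 1 1 - (g.1 0 1 : ℝ) * g.1 1 0 = 1 := by
  have hdet := g.2
  rw [Matrix.det_fin_two] at hdet
  exact_mod_cast hdet

theorem denom_ne_zero (hx : Irrational x) : denom g x ≠ 0 := by
  intro h
  rw [denom] at h
  have hdet := det_eq_one g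
  by_cases hc : (g.1 1 0 : ℝ) = 0
  · simp only [hc, zero_mul, zero_add] at h
    simp [hc, h] at hdet
  · refine hx ⟨-(g.1 1 1) / (g.1 1 0), ?_⟩
    push_cast
    field_simp
    linarith

variable {g} in
theorem moebius_mul_denom (hx : denom g x ≠ 0) :
    moebius g x * denom g x = (g.1 0 0 : ℝ) * x + g.1 0 1 :=
  div_mul_cancel₀ _ hx

theorem denom_mul (h : SL(2, ℤ)) (hx : denom h x ≠ 0) :
    denom (g * h) x = denom g (moebius h x) * denom h x := by
  have hmul := moebius_mul_denom hx
  simp only [denom, Matrix.SpecialLinearGroup.coe_mul, Matrix.mul_apply, Fin.sum_univ_two] at *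
  push_cast
  linear_combination -(g.1 1 0 : ℝ) * hmul

theorem moebius_mul (h : SL(2, ℤ)) (hx : Irrational x) :
    moebius (g * h) x = moebius g (moebius h x) := by
  have h1 := denom_ne_zero h hx
  have h2 := denom_ne_zero (g * h) hx
  have h3 : denom g (moebius h x) ≠ 0 := left_ne_zero_of_mul (denom_mul g h h1 ▸ h2)
  apply mul_right_cancel₀ h2
  rw [moebius_mul_denom h2, denom_mul g h h1, ← mul_assoc, moebius_mul_denom h3, add_mul,
    mul_assoc, moebius_mul_denom h1]
  simp only [denom, Matrix.SpecialLinearGroup.coe_mul, Matrix.mul_apply, Fin.sum_univ_two]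
  push_cast
  ring

theorem moebius_inv_moebius (hx : Irrational x) : moebius g⁻¹ (moebius g x) = x := by
  rw [← moebius_mul _ _ hx, inv_mul_cancel]
  simp [moebius]

theorem exists_ratCast_eq_moebius (q : ℚ) : ∃ r : ℚ, moebius g q = r :=
  ⟨(g.1 0 0 * q + g.1 0 1) / (g.1 1 0 * q + g.1 1 1), by simp [moebius]⟩

theorem irrational_moebius (hx : Irrational x) : Irrational (moebius g x) := by
  rintro ⟨q, hq⟩
  obtain ⟨r, hr⟩ := exists_ratCast_eq_moebius g⁻¹ q
  rw [hq, moebius_inv_moebius g hx] at hr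
  exact hx ⟨r, hr.symm⟩

theorem moebius_T_zpow (n : ℤ) : moebius (ModularGroup.T ^ n) x = x + n := by
  simp [moebius, ModularGroup.coe_T_zpow]

variable {g}

theorem moebius_sub (hx : denom g x ≠ 0) (hy : denom g y ≠ 0) :
    moebius g x - moebius g y = (x - y) / (denom g x * denom g y) := by
  rw [eq_div_iff (mul_ne_zero hx hy)]
  calc (moebius g x - moebius g y) * (denom g x * denom g y)
      = moebius g x * denom g x * denom g y - moebius g y * denom g y * denom g x := by ring
    _ = x - y := by
      rw [moebius_mul_denom hx, moebius_mul_denom hy, denom, denom]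
      linear_combination (x - y) * det_eq_one g

theorem coeff_ne_zero_of_pole (hz : denom g z = 0) : (g.1 1 0 : ℝ) ≠ 0 := by
  intro hc
  have hdet := det_eq_one g
  rw [denom, hc, zero_mul, zero_add] at hz
  simp [hc, hz] at hdet

theorem denom_eq_of_pole (hz : denom g z = 0) (x : ℝ) : denom g x = g.1 1 0 * (x - z) := by
  rw [denom] at *
  linear_combination hz

theorem denom_ne_zero_of_pole (hz : denom g z = 0) (hx : x ≠ z) : denom g x ≠ 0 := by
  rw [denom_eq_of_pole hz]
  exact mul_ne_zero (coeff_ne_zero_of_pole hz) (sub_ne_zero.2 hx)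

theorem exists_denom_ratCast_eq_zero (y : ℚ) : ∃ g : SL(2, ℤ), denom g y = 0 := by
  obtain ⟨g, hc, hd⟩ := (Rat.isCoprime_num_den y).symm.neg_right.exists_SL2_row 1
  refine ⟨g, ?_⟩
  rw [denom, hc, hd]
  push_cast
  rw [mul_comm, ← sub_eq_add_neg, sub_eq_zero]
  exact_mod_cast Rat.mul_den_eq_num y

theorem exists_pole_of_rat (r : ℚ) : ∃ (g : SL(2, ℤ)) (y : ℚ), denom g y = 0 ∧
    (g.1 0 0 : ℝ) / g.1 1 0 = r := by
  obtain ⟨g, h0, h1⟩ := (Rat.isCoprime_num_den r).exists_SL2_col 0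
  have hden : (g.1 1 0 : ℝ) ≠ 0 := by rw [h1]; exact_mod_cast r.den_ne_zero
  refine ⟨g, -(g.1 1 1) / g.1 1 0, ?_, ?_⟩
  · rw [denom]
    push_cast
    field_simp
    ring
  · rw [h0, h1]
    exact_mod_cast Rat.num_div_den r

theorem ConjPair.map_moebius (g : SL(2, ℤ)) (hx : Irrational x) (hy : Irrational y)
    (h : ConjPair w x y) : ConjPair w (moebius g x) (moebius g y) := by
  obtain ⟨hw, a, b, c, h1, h2, h3⟩ := h
  have hx' := denom_ne_zero g hx
  have hy' := denom_ne_zero g hy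
  have hlead : ((c * g.1 1 0 ^ 2 + b * g.1 1 0 * g.1 1 1 + a * g.1 1 1 ^ 2 : ℤ) : ℝ) =
      a * (denom g x * denom g y) := by
    push_cast
    rw [← h2, ← h3, denom, denom]
    ring
  refine ⟨hw, c * g.1 1 0 ^ 2 + b * g.1 1 0 * g.1 1 1 + a * g.1 1 1 ^ 2,
    2 * c * g.1 0 0 * g.1 1 0 + b * (g.1 0 0 * g.1 1 1 + g.1 0 1 * g.1 1 0) +
      2 * a * g.1 0 1 * g.1 1 1,
    c * g.1 0 0 ^ 2 + b * g.1 0 0 * g.1 0 1 + a * g.1 0 1 ^ 2, ?_, ?_, ?_⟩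
  · rw [hlead, moebius_sub hx' hy', ← h1]
    field_simp
  · rw [hlead, show a * (denom g x * denom g y) * (moebius g x + moebius g y) =
      a * (moebius g x * denom g x * denom g y + moebius g y * denom g y * denom g x) by ring,
      moebius_mul_denom hx', moebius_mul_denom hy', denom, denom]
    push_cast
    rw [← h2, ← h3]
    ring
  · rw [hlead, show a * (denom g x * denom g y) * (moebius g x * moebius g y) =
      a * (moebius g x * denom g x * (moebius g y * denom g y)) by ring,
      moebius_mul_denom hx', moebius_mul_denom hy']
    push_cast
    rw [← h2, ← h3]
    ring

end Moebius

/-! ### Orbit systems -/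

/-- The distance `|β - β^σ|` of a quadratic number to its conjugate. -/
def gap (β : ℝ) : ℝ := |β - galConj β|

theorem abs_galConj_sub_le (β γ : ℝ) : |galConj β - galConj γ| ≤ |β - γ| + gap β + gap γ := by
  rw [gap, gap, abs_sub_comm β (galConj β)]
  calc |galConj β - galConj γ| = |(β - γ) + (galConj β - β) + (γ - galConj γ)| := by
        congr 1; ring
    _ ≤ |β - γ| + |galConj β - β| + |γ - galConj γ| := abs_add_three _ _ _

/-- The properties of `Θ_α` used to describe its approximation constants: a nonempty set of
quadratic irrationals of common discriminant `w ^ 2`, stable under conjugation and the modular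
group. -/
structure OrbitSystem (w : ℝ) (S : Set ℝ) : Prop where
  nonempty : S.Nonempty
  irrational : ∀ β ∈ S, Irrational β
  conjPair : ∀ β ∈ S, ConjPair w β (galConj β)
  galConj_mem : ∀ β ∈ S, galConj β ∈ S
  moebius_mem : ∀ g, ∀ β ∈ S, moebius g β ∈ S

theorem orbitSystem_Theta {w α : ℝ} (hα : Irrational α) (h : ConjPair w α (galConj α)) :
    OrbitSystem w (Theta α) := by
  have hα' := h.irrational_right hα
  have hconj g : galConj (moebius g α) = moebius g (galConj α) :=
    (h.map_moebius g hα hα').galConj_eq (irrational_moebius g hα)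
  have hconj' g : galConj (moebius g (galConj α)) = moebius g α :=
    (h.symm.map_moebius g hα' hα).galConj_eq (irrational_moebius g hα')
  refine ⟨⟨moebius 1 α, 1, Or.inl rfl⟩, ?_, ?_, ?_, ?_⟩
  · rintro β ⟨g, rfl | rfl⟩
    exacts [irrational_moebius g hα, irrational_moebius g hα']
  · rintro β ⟨g, rfl | rfl⟩
    · exact hconj g ▸ h.map_moebius g hα hα'
    · exact hconj' g ▸ h.symm.map_moebius g hα' hα
  · rintro β ⟨g, rfl | rfl⟩
    exacts [⟨g, Or.inr (hconj g)⟩, ⟨g, Or.inl (hconj' g)⟩]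
  · rintro k β ⟨g, rfl | rfl⟩
    exacts [⟨k * g, Or.inl (moebius_mul k g hα).symm⟩, ⟨k * g, Or.inr (moebius_mul k g hα').symm⟩]

namespace OrbitSystem

variable {w : ℝ} {S : Set ℝ} {β γ : ℝ}

theorem one_le (H : OrbitSystem w S) : 1 ≤ w :=
  H.nonempty.elim fun β hβ ↦ (H.conjPair β hβ).one_le

theorem pos (H : OrbitSystem w S) : 0 < w := one_pos.trans_le H.one_le

theorem galConj_galConj (H : OrbitSystem w S) (hβ : β ∈ S) : galConj (galConj β) = β :=
  (H.conjPair β hβ).symm.galConj_eq (H.irrational _ (H.galConj_mem β hβ))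

theorem galConj_moebius (H : OrbitSystem w S) (hβ : β ∈ S) (g : SL(2, ℤ)) :
    galConj (moebius g β) = moebius g (galConj β) :=
  ((H.conjPair β hβ).map_moebius g (H.irrational β hβ)
    (H.irrational _ (H.galConj_mem β hβ))).galConj_eq (irrational_moebius g (H.irrational β hβ))

theorem gap_pos (H : OrbitSystem w S) (hβ : β ∈ S) : 0 < gap β :=
  abs_pos.2 (sub_ne_zero.2 (H.conjPair β hβ).ne)

theorem gap_le (H : OrbitSystem w S) (hβ : β ∈ S) : gap β ≤ w := (H.conjPair β hβ).abs_sub_le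

theorem gap_galConj (H : OrbitSystem w S) (hβ : β ∈ S) : gap (galConj β) = gap β := by
  rw [gap, H.galConj_galConj hβ, abs_sub_comm, gap]

theorem ratCast_ne (H : OrbitSystem w S) (hβ : β ∈ S) (q : ℚ) : (q : ℝ) ≠ β :=
  ((H.irrational β hβ).ne_rat q).symm

theorem exists_moebius_eq (H : OrbitSystem w S) (g : SL(2, ℤ)) (hβ : β ∈ S) :
    ∃ γ ∈ S, moebius g γ = β :=
  ⟨_, H.moebius_mem g⁻¹ β hβ,
    by simpa only [inv_inv] using moebius_inv_moebius g⁻¹ (H.irrational β hβ)⟩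

theorem add_int_mem (H : OrbitSystem w S) (hβ : β ∈ S) (n : ℤ) : β + n ∈ S :=
  moebius_T_zpow (x := β) n ▸ H.moebius_mem (ModularGroup.T ^ n) β hβ

theorem galConj_add_int (H : OrbitSystem w S) (hβ : β ∈ S) (n : ℤ) :
    galConj (β + n) = galConj β + n := by
  rw [← moebius_T_zpow, H.galConj_moebius hβ, moebius_T_zpow]

theorem gap_add_int (H : OrbitSystem w S) (hβ : β ∈ S) (n : ℤ) : gap (β + n) = gap β := by
  rw [gap, H.galConj_add_int hβ, add_sub_add_right_eq_sub, gap]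

theorem gap_moebius_of_pole (H : OrbitSystem w S) (hβ : β ∈ S) {g : SL(2, ℤ)} {y : ℚ}
    (hy : denom g y = 0) :
    gap (moebius g β) = gap β / ((g.1 1 0 : ℝ) ^ 2 * (|β - y| * |galConj β - y|)) := by
  have hne := denom_ne_zero g (H.irrational β hβ)
  have hne' := denom_ne_zero g (H.irrational _ (H.galConj_mem β hβ))
  rw [gap, H.galConj_moebius hβ, moebius_sub hne hne', abs_div, gap, denom_eq_of_pole hy,
    denom_eq_of_pole hy]
  simp only [abs_mul]
  rw [mul_mul_mul_comm, ← sq, sq_abs]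

theorem separation (H : OrbitSystem w S) (hβ : β ∈ S) (hγ : γ ∈ S) (h : β ≠ γ) :
    gap β * gap γ ≤ 2 * w ^ 2 * (|β - γ| * |galConj β - galConj γ|) := by
  refine (H.conjPair β hβ).separation (H.conjPair γ hγ) h fun e ↦ h ?_
  rw [← H.galConj_galConj hβ, e, H.galConj_galConj hγ]

end OrbitSystem

/-! ### Avoiding sparse sets -/

theorem exists_seq_of_forall_exists {X : Type*} {P : ℕ → X → Prop} {R : ℕ → X → X → Prop}
    {x₀ : X} (h₀ : P 0 x₀) (step : ∀ n x, P n x → ∃ y, P (n + 1) y ∧ R n x y) :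
    ∃ u : ℕ → X, u 0 = x₀ ∧ ∀ n, P n (u n) ∧ R n (u n) (u (n + 1)) := by
  choose! f hP hR using step
  let u : ℕ → X := fun n ↦ Nat.rec x₀ f n
  have hu n : P n (u n) := by
    induction n with
    | zero => exact h₀
    | succ n ih => exact hP n _ ih
  exact ⟨u, rfl, fun n ↦ ⟨hu n, hR n _ (hu n)⟩⟩

/-- The points of `C` at distance at most `l` of each other are much closer than `l`. -/
def SparseAt (l : ℝ) (C : Set ℝ) : Prop :=
  ∀ s ∈ C, ∀ t ∈ C, |s - t| ≤ l → |s - t| < l / 8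

theorem SparseAt.lt_of_mem {l s t : ℝ} {C : Set ℝ} (hC : SparseAt l C) (hs : s ∈ C) (ht : t ∈ C)
    (hst : s ≤ t) (htl : t ≤ s + l) : t < s + l / 8 := by
  have h := hC t ht s hs (abs_le.2 ⟨by linarith, by linarith⟩)
  linarith [(abs_lt.1 h).2]

/-- Of the three quarters of `[p, p + l]` separated by gaps of length `l / 8`, each of the two
sparse sets meets at most one. -/
theorem exists_Icc_forall_notMem {A B : Set ℝ} {l : ℝ} (hl : 0 ≤ l) (hA : SparseAt l A)
    (hB : SparseAt l B) (p : ℝ) : ∃ p', p ≤ p' ∧ p' + l / 4 ≤ p + l ∧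
      ∀ t ∈ Set.Icc p' (p' + l / 4), t ∉ A ∧ t ∉ B := by
  by_contra! hcon
  obtain ⟨t₁, ⟨h1, h1'⟩, hB₁⟩ := hcon p le_rfl (by linarith)
  obtain ⟨t₂, ⟨h2, h2'⟩, hB₂⟩ := hcon (p + 3 / 8 * l) (by linarith) (by linarith)
  obtain ⟨t₃, ⟨h3, h3'⟩, hB₃⟩ := hcon (p + 3 / 4 * l) (by linarith) (by linarith)
  have hnot {C : Set ℝ} (hC : SparseAt l C) {s t : ℝ} (hps : p ≤ s) (hst : s + l / 8 ≤ t)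
      (htp : t ≤ p + l) (hs : s ∈ C) (ht : t ∈ C) : False :=
    hst.not_gt (hC.lt_of_mem hs ht (by linarith) (by linarith))
  have h₁₂ {C : Set ℝ} (hC : SparseAt l C) := hnot hC h1 (t := t₂) (by linarith) (by linarith)
  have h₁₃ {C : Set ℝ} (hC : SparseAt l C) := hnot hC h1 (t := t₃) (by linarith) (by linarith)
  have h₂₃ {C : Set ℝ} (hC : SparseAt l C) :=
    hnot hC (s := t₂) (t := t₃) (by linarith) (by linarith) (by linarith)
  by_cases m₁ : t₁ ∈ A <;> by_cases m₂ : t₂ ∈ A <;> by_cases m₃ : t₃ ∈ A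
  all_goals
    first
    | exact h₁₂ hA m₁ m₂
    | exact h₁₃ hA m₁ m₃
    | exact h₂₃ hA m₂ m₃
    | exact h₁₂ hB (hB₁ m₁) (hB₂ m₂)
    | exact h₁₃ hB (hB₁ m₁) (hB₃ m₃)
    | exact h₂₃ hB (hB₂ m₂) (hB₃ m₃)

theorem exists_mem_Icc_forall_notMem {A B : ℕ → Set ℝ} (hA : ∀ j, SparseAt ((1 / 4) ^ j) (A j))
    (hB : ∀ j, SparseAt ((1 / 4) ^ j) (B j)) (p₀ : ℝ) :
    ∃ η ∈ Set.Icc p₀ (p₀ + 1), ∀ j, η ∉ A j ∧ η ∉ B j := by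
  obtain ⟨p, hp₀, hp⟩ := exists_seq_of_forall_exists (P := fun _ _ ↦ True) (x₀ := p₀) trivial
    (fun j p _ ↦ (exists_Icc_forall_notMem (by positivity) (hA j) (hB j) p).imp
      fun _ h ↦ ⟨trivial, h⟩)
  have hpow (j : ℕ) : (1 / 4 : ℝ) ^ j / 4 = (1 / 4) ^ (j + 1) := by ring
  simp only [true_and, hpow] at hp
  have hmono : Monotone p := monotone_nat_of_le_succ fun j ↦ (hp j).1
  have hanti : Antitone fun j ↦ p j + (1 / 4 : ℝ) ^ j :=
    antitone_nat_of_succ_le fun j ↦ (hp j).2.1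
  have hmem := hmono.ciSup_mem_iInter_Icc_of_antitone hanti fun j ↦ by simp
  rw [Set.mem_iInter] at hmem
  refine ⟨_, ?_, fun j ↦ (hp j).2.2 _ (hmem (j + 1))⟩
  simpa [hp₀] using hmem 0

/-! ### Points that are badly approximable by an orbit -/

/-- The ratio `2 |ξ - β| / |β - β^σ|` whose lower limit is the approximation constant of `ξ`. -/
def approxRatio (ξ β : ℝ) : ℝ := 2 * |ξ - β| / gap β

theorem approxRatio_nonneg (ξ β : ℝ) : 0 ≤ approxRatio ξ β :=
  div_nonneg (by positivity) (abs_nonneg _)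

theorem abs_approxRatio_sub_le (ξ ξ' β : ℝ) :
    |approxRatio ξ β - approxRatio ξ' β| ≤ 2 * |ξ - ξ'| / gap β := by
  have hgap : 0 ≤ gap β := abs_nonneg _
  rw [approxRatio, approxRatio, ← sub_div, abs_div, abs_of_nonneg hgap, ← mul_sub, abs_mul, abs_two]
  gcongr 2 * ?_ / gap β
  simpa only [sub_sub_sub_cancel_right] using abs_abs_sub_abs_le (ξ - β) (ξ' - β)

/-- On `[1, 2]` the curve `φ` moves at a speed comparable to `X`. The constant `13` is the one
needed for the curves of `exists_pair_crossRatio`. -/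
structure HasSpeed (X : ℝ) (φ : ℝ → ℝ) : Prop where
  pos : 0 < X
  lower : ∀ s ∈ Set.Icc (1 : ℝ) 2, ∀ t ∈ Set.Icc (1 : ℝ) 2, X * |s - t| ≤ 13 * |φ s - φ t|
  upper : ∀ s ∈ Set.Icc (1 : ℝ) 2, ∀ t ∈ Set.Icc (1 : ℝ) 2, |φ s - φ t| ≤ X * |s - t|

/-- The parameters `t ∈ [1, 2]` for which `φ t` is well approximable by an element of `S` whose gap
is comparable to `w ^ 2 L`. -/
def wellApproxSet (S : Set ℝ) (w κ L : ℝ) (φ : ℝ → ℝ) : Set ℝ :=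
  {t | t ∈ Set.Icc 1 2 ∧ ∃ β ∈ S, 16 * w ^ 2 * L < gap β ∧ gap β ≤ 64 * w ^ 2 * L ∧
    approxRatio (φ t) β < κ}

theorem exists_nat_scale {g X v : ℝ} (hg : 0 < g) (hX : 0 < X) (hv : 0 < v)
    (h : g ≤ 64 * v * X) :
    ∃ j : ℕ, 16 * v * (X * (1 / 4) ^ j) < g ∧ g ≤ 64 * v * (X * (1 / 4) ^ j) := by
  have hp : 0 < 64 * v * X := by positivity
  obtain ⟨j, h1, h2⟩ := exists_nat_pow_near_of_lt_one (div_pos hg hp) ((div_le_one hp).2 h)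
    (by norm_num : (0 : ℝ) < 1 / 4) (by norm_num)
  rw [lt_div_iff₀ hp, pow_succ] at h1
  rw [div_le_iff₀ hp] at h2
  exact ⟨j, by linarith, by linarith⟩

namespace OrbitSystem

variable {w : ℝ} {S : Set ℝ} {β γ : ℝ}

theorem le_approxRatio_iff (H : OrbitSystem w S) (hβ : β ∈ S) {κ ξ : ℝ} :
    κ ≤ approxRatio ξ β ↔ κ * gap β ≤ 2 * |ξ - β| :=
  le_div_iff₀ (H.gap_pos hβ)

theorem approxRatio_lt_iff (H : OrbitSystem w S) (hβ : β ∈ S) {κ ξ : ℝ} :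
    approxRatio ξ β < κ ↔ 2 * |ξ - β| < κ * gap β :=
  div_lt_iff₀ (H.gap_pos hβ)

theorem lt_abs_sub_of_lt_gap (H : OrbitSystem w S) (hβ : β ∈ S) (hγ : γ ∈ S) (hne : β ≠ γ) {L : ℝ}
    (hL : 0 < L) (hβL : 16 * w ^ 2 * L < gap β) (hγL : 16 * w ^ 2 * L < gap γ) :
    2 * L < |β - γ| := by
  by_contra! hcon
  have hw2 : 1 ≤ w ^ 2 := one_le_pow₀ H.one_le
  have hL16 : 16 * L ≤ 16 * w ^ 2 * L := by nlinarith
  have hprod : |β - γ| * |galConj β - galConj γ| ≤ 2 * L * (2 * (gap β + gap γ)) := by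
    gcongr
    linarith [abs_galConj_sub_le β γ]
  have hsep : gap β * gap γ ≤ 8 * w ^ 2 * L * (gap β + gap γ) :=
    calc gap β * gap γ ≤ 2 * w ^ 2 * (|β - γ| * |galConj β - galConj γ|) := H.separation hβ hγ hne
      _ ≤ 2 * w ^ 2 * (2 * L * (2 * (gap β + gap γ))) := by gcongr
      _ = 8 * w ^ 2 * L * (gap β + gap γ) := by ring
  have h1 := mul_lt_mul_of_pos_right hβL (H.gap_pos hγ)
  have h2 := mul_lt_mul_of_pos_right hγL (H.gap_pos hβ)
  linarith

theorem sparseAt_wellApproxSet (H : OrbitSystem w S) {κ X l : ℝ} {φ : ℝ → ℝ}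
    (hκ : κ * (16000 * w ^ 2) ≤ 1) (hφ : HasSpeed X φ) (hl : 0 < l) :
    SparseAt l (wellApproxSet S w κ (X * l) φ) := by
  rintro s ⟨hs, β, hβ, hβ₁, hβ₂, hβ₃⟩ t ⟨ht, γ, hγ, hγ₁, hγ₂, hγ₃⟩ hst
  have hX := hφ.pos
  have hκ0 : 0 < κ := (approxRatio_nonneg _ _).trans_lt hβ₃
  have hclose {u τ : ℝ} (hτ : τ ∈ S) (hgap : gap τ ≤ 64 * w ^ 2 * (X * l))
      (h : approxRatio (φ u) τ < κ) : |φ u - τ| < X * l / 500 := by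
    rw [H.approxRatio_lt_iff hτ] at h
    have : κ * gap τ ≤ X * l / 250 := calc
      κ * gap τ ≤ κ * (64 * w ^ 2 * (X * l)) := by gcongr
      _ = κ * (16000 * w ^ 2) * (X * l / 250) := by ring
      _ ≤ 1 * (X * l / 250) := by gcongr
      _ = X * l / 250 := one_mul _
    linarith
  have hs' := hclose hβ hβ₂ hβ₃
  have ht' := hclose hγ hγ₂ hγ₃
  rw [abs_sub_comm] at hs'
  obtain rfl | hne := eq_or_ne β γ
  · have hdist : |φ s - φ t| ≤ |β - φ s| + |φ t - β| := by
      rw [abs_sub_comm β, abs_sub_comm (φ t)]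
      exact abs_sub_le _ _ _
    have hlow := hφ.lower s hs t ht
    exact lt_of_mul_lt_mul_left (by linarith [mul_pos hX hl]) hX.le
  · exfalso
    have hdist : |β - γ| ≤ |β - φ s| + |φ s - φ t| + |φ t - γ| :=
      (abs_sub_le _ (φ t) _).trans (by gcongr; exact abs_sub_le _ _ _)
    have hup : |φ s - φ t| ≤ X * l := (hφ.upper s hs t ht).trans (by gcongr)
    linarith [H.lt_abs_sub_of_lt_gap hβ hγ hne (mul_pos hX hl) hβ₁ hγ₁, mul_pos hX hl]

theorem exists_mem_Icc_forall_le_approxRatio (H : OrbitSystem w S) {κ X Y : ℝ} {φ ψ : ℝ → ℝ}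
    (hκ : κ * (16000 * w ^ 2) ≤ 1) (hφ : HasSpeed X φ) (hψ : HasSpeed Y ψ) :
    ∃ η ∈ Set.Icc (1 : ℝ) 2, ∀ β ∈ S, (gap β ≤ 64 * w ^ 2 * X → κ ≤ approxRatio (φ η) β) ∧
      (gap β ≤ 64 * w ^ 2 * Y → κ ≤ approxRatio (ψ η) β) := by
  obtain ⟨η, hη, havoid⟩ := exists_mem_Icc_forall_notMem
    (fun j ↦ H.sparseAt_wellApproxSet hκ hφ (l := (1 / 4) ^ j) (by positivity))
    (fun j ↦ H.sparseAt_wellApproxSet hκ hψ (l := (1 / 4) ^ j) (by positivity)) 1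
  rw [one_add_one_eq_two] at hη
  have hw : 0 < w ^ 2 := pow_pos H.pos 2
  refine ⟨η, hη, fun β hβ ↦ ⟨fun hgap ↦ ?_, fun hgap ↦ ?_⟩⟩ <;> by_contra! hlt
  · obtain ⟨j, h1, h2⟩ := exists_nat_scale (H.gap_pos hβ) hφ.pos hw hgap
    exact (havoid j).1 ⟨hη, β, hβ, h1, h2, hlt⟩
  · obtain ⟨j, h1, h2⟩ := exists_nat_scale (H.gap_pos hβ) hψ.pos hw hgap
    exact (havoid j).2 ⟨hη, β, hβ, h1, h2, hlt⟩

end OrbitSystem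

/-- Twice the absolute cross ratio of `x, y` and the conjugate pair of `β`: the value that
`approxRatio` takes once a fractional linear transformation has moved `y` to infinity. -/
def crossRatio (x y β : ℝ) : ℝ := 2 * (|x - β| * |y - galConj β|) / (|x - y| * gap β)

theorem hasSpeed_affine (a : ℝ) {d : ℝ} (hd : 0 < d) : HasSpeed d fun η ↦ a + d * η := by
  have hdist (s t : ℝ) : |(a + d * s) - (a + d * t)| = d * |s - t| := by
    rw [add_sub_add_left_eq_sub, ← mul_sub, abs_mul, abs_of_pos hd]
  refine ⟨hd, fun s _ t _ ↦ ?_, fun s _ t _ ↦ (hdist s t).le⟩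
  rw [hdist]
  linarith [mul_nonneg hd.le (abs_nonneg (s - t))]

theorem hasSpeed_mul_div_add (a : ℝ) {X k : ℝ} (hX : 0 < X) (hk : 1 ≤ k) (hk' : k ≤ 3 / 2) :
    HasSpeed X fun η ↦ a + X * η / (k + η) := by
  have hdist {s t : ℝ} (hs : 1 ≤ s) (ht : 1 ≤ t) :
      |(a + X * s / (k + s)) - (a + X * t / (k + t))| =
        X * |s - t| * (k / ((k + s) * (k + t))) := by
    have hs' : 0 < k + s := by linarith
    have ht' : 0 < k + t := by linarith
    rw [show (a + X * s / (k + s)) - (a + X * t / (k + t)) =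
      X * (s - t) * (k / ((k + s) * (k + t))) by field_simp; ring, abs_mul, abs_mul,
      abs_of_pos hX, abs_of_pos (div_pos (by linarith) (mul_pos hs' ht'))]
  refine ⟨hX, fun s hs t ht ↦ ?_, fun s hs t ht ↦ ?_⟩ <;> rw [hdist hs.1 ht.1]
  · have hrate : 1 / 13 ≤ k / ((k + s) * (k + t)) := by
      rw [div_le_div_iff₀ (by norm_num) (mul_pos (by linarith [hs.1]) (by linarith [ht.1]))]
      have : (k + s) * (k + t) ≤ (k + 2) * (k + 2) := by
        gcongr <;> linarith [hs.1, hs.2, ht.1, ht.2]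
      nlinarith
    have := mul_le_mul_of_nonneg_left hrate (by positivity : 0 ≤ X * |s - t|)
    linarith
  · refine mul_le_of_le_one_right (by positivity) ?_
    rw [div_le_one (mul_pos (by linarith [hs.1]) (by linarith [ht.1]))]
    nlinarith [hs.1, ht.1]

theorem exists_rat_abs_sub_le_one_div_sq (z : ℝ) {η : ℝ} (hη : 0 < η) :
    ∃ q : ℚ, |z - q| < η ∧ |z - q| ≤ 1 / (q.den : ℝ) ^ 2 := by
  obtain ⟨n, hn⟩ := exists_nat_one_div_lt hη
  obtain ⟨q, hq, hden⟩ := Real.exists_rat_abs_sub_le_and_den_le z (Nat.succ_pos n)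
  have hone : (1 : ℝ) ≤ q.den := by exact_mod_cast q.den_pos
  have hden' : (q.den : ℝ) ≤ n + 1 := by exact_mod_cast hden
  push_cast at hq
  refine ⟨q, (hq.trans (one_div_le_one_div_of_le (by positivity) ?_)).trans_lt hn,
    hq.trans (one_div_le_one_div_of_le (by positivity) ?_)⟩ <;> nlinarith

namespace OrbitSystem

variable {w : ℝ} {S : Set ℝ} {α β γ : ℝ}

theorem one_le_mul_abs_sub_of_lt_gap (H : OrbitSystem w S) (hβ : β ∈ S) {q : ℚ}
    (h : |q - β| < gap β) : 1 ≤ 2 * w * q.den ^ 2 * |q - β| := by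
  have hgap := H.gap_pos hβ
  have hw := H.pos
  have htri : |q - galConj β| ≤ 2 * gap β := by
    have := abs_sub_le (q : ℝ) β (galConj β)
    rw [← gap] at this
    linarith
  have hsep := (H.conjPair β hβ).abs_sub_le_of_rat q (H.ratCast_ne hβ q)
    (H.ratCast_ne (H.galConj_mem β hβ) q)
  refine le_of_mul_le_mul_right ?_ hgap
  calc 1 * gap β ≤ w * q.den ^ 2 * (|q - β| * |q - galConj β|) := by rwa [one_mul]
    _ ≤ w * q.den ^ 2 * (|q - β| * (2 * gap β)) := by gcongr
    _ = 2 * w * q.den ^ 2 * |q - β| * gap β := by ring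

theorem le_approxRatio_of_abs_sub_le (H : OrbitSystem w S) (hβ : β ∈ S) {κ z : ℝ} {q : ℚ}
    (hκ : 0 < κ) (hκ1 : κ ≤ 1) (hz : κ ≤ approxRatio z β) (hq : |z - q| ≤ 1 / (q.den : ℝ) ^ 2) :
    κ / (4 * w) ≤ approxRatio q β := by
  have hw := H.one_le
  have hgap := H.gap_pos hβ
  have hden : (0 : ℝ) < q.den := by exact_mod_cast q.den_pos
  rw [H.le_approxRatio_iff hβ] at hz ⊢
  have hle : κ / (4 * w) * gap β ≤ κ / 4 * gap β := by gcongr; linarith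
  have hκgap : κ * gap β ≤ gap β := mul_le_of_le_one_left hgap.le hκ1
  rcases le_or_gt (gap β) |q - β| with hfar | hnear
  · linarith
  rcases le_or_gt 4 (gap β * q.den ^ 2 * κ) with hlarge | hsmall
  · have : 1 / (q.den : ℝ) ^ 2 ≤ κ * gap β / 4 := by
      rw [div_le_iff₀ (by positivity)]; linarith
    linarith [abs_sub_le z q β, mul_pos hκ hgap]
  · calc κ / (4 * w) * gap β
        ≤ κ / (4 * w) * gap β * (2 * w * q.den ^ 2 * |q - β|) :=
          le_mul_of_one_le_right (by positivity) (H.one_le_mul_abs_sub_of_lt_gap hβ hnear)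
      _ = gap β * q.den ^ 2 * κ / 2 * |q - β| := by field_simp; norm_num
      _ ≤ 2 * |q - β| := by gcongr; linarith

theorem exists_maximal_gap (H : OrbitSystem w S) :
    ∃ α ∈ S, galConj α < α ∧ ∀ β ∈ S, gap β ≤ gap α := by
  have hmul : ∀ β ∈ S, ∃ n : ℕ, n * gap β = w := fun β hβ ↦ by
    obtain ⟨a, -, -, -, ha, -⟩ := (H.conjPair β hβ).exists_abs_mul_eq
    exact ⟨a.natAbs, by rwa [Nat.cast_natAbs, Int.cast_abs]⟩
  obtain ⟨α, hα, hmax⟩ : ∃ α ∈ S, ∀ β ∈ S, gap β ≤ gap α := by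
    classical
    have hex : ∃ n : ℕ, ∃ β ∈ S, n * gap β = w :=
      H.nonempty.elim fun β hβ ↦ (hmul β hβ).imp fun _ hn ↦ ⟨β, hβ, hn⟩
    obtain ⟨α, hα, hfind⟩ := Nat.find_spec hex
    refine ⟨α, hα, fun β hβ ↦ ?_⟩
    obtain ⟨m, hm⟩ := hmul β hβ
    have hle : (Nat.find hex : ℝ) ≤ m := by exact_mod_cast Nat.find_min' hex ⟨β, hβ, hm⟩
    have hpos : (0 : ℝ) < Nat.find hex := pos_of_mul_pos_left (hfind.symm ▸ H.pos) (H.gap_pos hα).le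
    refine le_of_mul_le_mul_left ?_ hpos
    calc _ ≤ (m : ℝ) * gap β := by gcongr; exact abs_nonneg _
      _ = Nat.find hex * gap α := hm.trans hfind.symm
  rcases lt_or_gt_of_ne (H.conjPair α hα).ne with h | h
  · exact ⟨galConj α, H.galConj_mem α hα, by rwa [H.galConj_galConj hα],
      fun β hβ ↦ (hmax β hβ).trans_eq (H.gap_galConj hα).symm⟩
  · exact ⟨α, hα, h, hmax⟩

theorem gap_le_mul_abs_sub (H : OrbitSystem w S) (hα : α ∈ S) (hγ : γ ∈ S) (hne : γ ≠ α)
    (hgap : gap γ ≤ gap α) : gap γ ≤ 6 * w ^ 2 * |α - γ| := by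
  have hw2 : 1 ≤ w ^ 2 := one_le_pow₀ H.one_le
  rcases le_or_gt (gap γ) |α - γ| with hfar | hnear
  · nlinarith [abs_nonneg (α - γ)]
  refine le_of_mul_le_mul_left ?_ (H.gap_pos hα)
  calc gap α * gap γ ≤ 2 * w ^ 2 * (|α - γ| * |galConj α - galConj γ|) :=
        H.separation hα hγ hne.symm
    _ ≤ 2 * w ^ 2 * (|α - γ| * (3 * gap α)) := by
        gcongr
        linarith [abs_galConj_sub_le α γ]
    _ = gap α * (6 * w ^ 2 * |α - γ|) := by ring

theorem le_approxRatio_of_lt_gap (H : OrbitSystem w S) (hα : α ∈ S) (hβ : β ∈ S) (hne : β ≠ α)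
    {κ x X : ℝ} (hκ : κ * (16000 * w ^ 2) ≤ 1) (hx : |α - x| ≤ X) (hgap : gap β ≤ gap α)
    (hlt : 64 * w ^ 2 * X < gap β) : κ ≤ approxRatio x β := by
  have hw2 : 0 < w ^ 2 := pow_pos H.pos 2
  have hdist : gap β ≤ 6 * w ^ 2 * (X + |x - β|) :=
    (H.gap_le_mul_abs_sub hα hβ hne hgap).trans (by gcongr; linarith [abs_sub_le α x β])
  rw [H.le_approxRatio_iff hβ]
  have hκg : κ * gap β * (16000 * w ^ 2) ≤ gap β := by
    nlinarith [mul_le_mul_of_nonneg_right hκ (H.gap_pos hβ).le]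
  refine le_of_mul_le_mul_right (a := 16000 * w ^ 2) ?_ (by positivity)
  nlinarith [mul_nonneg hw2.le (abs_nonneg (x - β))]

/-- The curves `η ↦ x, y` below keep the cross ratio with `α` equal to `c`, so `η` is free to be
chosen away from the well approximable parameters. -/
theorem exists_pair_crossRatio (H : OrbitSystem w S) (hα : α ∈ S) (hlt : galConj α < α)
    (hmax : ∀ β ∈ S, gap β ≤ gap α) {c κ : ℝ} (hc : 0 < c) (hc1 : c ≤ 1)
    (hκ : κ * (16000 * w ^ 2) ≤ 1) :
    ∃ x y, α + gap α ≤ y ∧ y ≤ α + 2 * gap α ∧ α < x ∧ x ≤ α + c * gap α / 2 ∧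
      crossRatio x y α = c ∧ (∀ β ∈ S, β ≠ α → κ ≤ approxRatio x β) ∧
      ∀ β ∈ S, κ ≤ approxRatio y β := by
  have hd := H.gap_pos hα
  have hconj : galConj α = α - gap α := by rw [gap, abs_of_pos (sub_pos.2 hlt)]; ring
  set d := gap α
  have hX : 0 < c * d / 2 := by positivity
  obtain ⟨η, ⟨hη1, hη2⟩, hbad⟩ := H.exists_mem_Icc_forall_le_approxRatio hκ
    (hasSpeed_mul_div_add α hX (k := 1 + c / 2) (by linarith) (by linarith)) (hasSpeed_affine α hd)
  have hk : 0 < 1 + c / 2 + η := by linarith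
  set x := α + c * d / 2 * η / (1 + c / 2 + η) with hx
  set y := α + d * η with hy
  have hαx : α < x := lt_add_of_pos_right _ (by positivity)
  have hxX : x ≤ α + c * d / 2 := by
    rw [hx, add_le_add_iff_left]
    rw [div_le_iff₀ hk]
    nlinarith
  have hdη : d ≤ d * η := le_mul_of_one_le_right hd.le hη1
  have hxy : x < y := by nlinarith
  refine ⟨x, y, by linarith, by nlinarith, hαx, hxX, ?_, fun β hβ hne ↦ ?_, fun β hβ ↦ ?_⟩
  · rw [crossRatio, abs_of_pos (sub_pos.2 hαx), abs_of_pos (by linarith : 0 < y - galConj α),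
      abs_sub_comm, abs_of_pos (sub_pos.2 hxy),
      div_eq_iff (mul_pos (sub_pos.2 hxy) hd).ne', hconj, hx, hy]
    field_simp
    ring
  · rcases le_or_gt (gap β) (64 * w ^ 2 * (c * d / 2)) with hle | hgt
    · exact (hbad β hβ).1 hle
    · refine H.le_approxRatio_of_lt_gap hα hβ hne hκ ?_ (hmax β hβ) hgt
      rw [abs_sub_comm, abs_of_pos (sub_pos.2 hαx)]
      linarith
  · refine (hbad β hβ).2 ((hmax β hβ).trans (le_mul_of_one_le_left hd.le ?_))
    linarith [one_le_pow₀ H.one_le (n := 2)]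

theorem le_crossRatio_iff (H : OrbitSystem w S) (hβ : β ∈ S) {x y κ : ℝ} (hxy : x ≠ y) :
    κ ≤ crossRatio x y β ↔ κ * (|x - y| * gap β) ≤ 2 * (|x - β| * |y - galConj β|) :=
  le_div_iff₀ (mul_pos (abs_pos.2 (sub_ne_zero.2 hxy)) (H.gap_pos hβ))

/-- Unless `γ` is close to `x` and `γ^σ` to `y`, one of the two distances is comparable to `gap α`;
otherwise `gap γ` is comparable to `gap α` and `γ` is repelled by `α`. -/
theorem div_le_crossRatio (H : OrbitSystem w S) (hα : α ∈ S) (hmax : ∀ β ∈ S, gap β ≤ gap α)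
    {κ x y : ℝ} (hκ : 0 < κ) (hx : |x - α| * (100 * w ^ 2) ≤ gap α)
    (hxy : 9 / 10 * gap α ≤ |x - y|) (hxy' : |x - y| ≤ 21 / 10 * gap α) (hγ : γ ∈ S) (hne : γ ≠ α)
    (hxγ : κ ≤ approxRatio x γ) (hyγ : κ ≤ approxRatio y (galConj γ)) :
    κ / (130 * w ^ 2) ≤ crossRatio x y γ := by
  have hw2 : 1 ≤ w ^ 2 := one_le_pow₀ H.one_le
  have hd := H.gap_pos hα
  have hg := H.gap_pos hγ
  rw [H.le_approxRatio_iff hγ] at hxγ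
  rw [H.le_approxRatio_iff (H.galConj_mem γ hγ), H.gap_galConj hγ] at hyγ
  rw [H.le_crossRatio_iff hγ (sub_ne_zero.1 (abs_pos.1 (by linarith)))]
  have hgoal : κ / (130 * w ^ 2) * (|x - y| * gap γ) ≤ κ * gap γ * gap α / (60 * w ^ 2) := calc
    _ ≤ κ / (130 * w ^ 2) * (21 / 10 * gap α * gap γ) := by gcongr
    _ = κ * gap γ * gap α * (21 / 1300 / w ^ 2) := by field_simp; norm_num
    _ ≤ κ * gap γ * gap α * (1 / 60 / w ^ 2) := by gcongr κ * gap γ * gap α * (?_ / w ^ 2); norm_num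
    _ = κ * gap γ * gap α / (60 * w ^ 2) := by field_simp
  refine hgoal.trans ?_
  have hweak : κ * gap γ * gap α / (60 * w ^ 2) ≤ κ * gap γ * gap α / 60 := by gcongr; linarith
  have hprod : 0 < κ * gap γ * gap α := by positivity
  rcases le_or_gt (gap α / 2) |y - galConj γ| with hy | hy
  · have := mul_le_mul hxγ hy (by positivity) (by positivity)
    linarith
  rcases le_or_gt (gap α / 5) |x - γ| with hA | hA
  · have := mul_le_mul hA hyγ (by positivity) (by positivity)
    linarith
  have hgap : gap α / 5 ≤ gap γ := by
    have h1 := abs_sub_le x γ y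
    have h2 := abs_sub_le γ (galConj γ) y
    rw [abs_sub_comm (galConj γ) y, ← gap] at h2
    linarith
  have hrepel : gap γ ≤ 6 * w ^ 2 * (|x - α| + |x - γ|) :=
    (H.gap_le_mul_abs_sub hα hγ hne (hmax γ hγ)).trans <| by
      gcongr
      rw [abs_sub_comm x α]
      exact abs_sub_le _ _ _
  have hlow : gap α / (60 * w ^ 2) ≤ |x - γ| := by
    rw [div_le_iff₀ (by positivity)]
    linarith
  calc κ * gap γ * gap α / (60 * w ^ 2) = gap α / (60 * w ^ 2) * (κ * gap γ) := by ring
    _ ≤ |x - γ| * (2 * |y - galConj γ|) := by gcongr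
    _ = 2 * (|x - γ| * |y - galConj γ|) := by ring

theorem approxRatio_moebius_of_pole (H : OrbitSystem w S) (hγ : γ ∈ S) {g : SL(2, ℤ)} {x : ℝ}
    {y : ℚ} (hy : denom g y = 0) (hxy : x ≠ y) :
    approxRatio (moebius g x) (moebius g γ) = crossRatio x y γ := by
  have hγ' := denom_ne_zero g (H.irrational γ hγ)
  have hx' := denom_ne_zero_of_pole hy hxy
  have hc := coeff_ne_zero_of_pole hy
  have h1 : |γ - y| ≠ 0 := abs_ne_zero.2 (sub_ne_zero.2 (H.ratCast_ne hγ y).symm)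
  have h2 : |x - y| ≠ 0 := abs_ne_zero.2 (sub_ne_zero.2 hxy)
  have hgap := (H.gap_pos hγ).ne'
  rw [approxRatio, crossRatio, moebius_sub hx' hγ', H.gap_moebius_of_pole hγ hy,
    denom_eq_of_pole hy, denom_eq_of_pole hy, abs_div, abs_mul, abs_mul, abs_mul,
    ← sq_abs (g.1 1 0 : ℝ), abs_sub_comm (y : ℝ) (galConj γ)]
  have hc' : |(g.1 1 0 : ℝ)| ≠ 0 := abs_ne_zero.2 hc
  field_simp

variable {c ε : ℝ}

theorem continuousAt_crossRatio (H : OrbitSystem w S) (hβ : β ∈ S) {x y : ℝ} (hxy : x ≠ y) :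
    ContinuousAt (fun p : ℝ × ℝ ↦ crossRatio p.1 p.2 β) (x, y) :=
  ContinuousAt.div (by fun_prop) (by fun_prop)
    (mul_pos (abs_pos.2 (sub_ne_zero.2 hxy)) (H.gap_pos hβ)).ne'

theorem exists_rat_near_forall_le_crossRatio (H : OrbitSystem w S) (hα : α ∈ S)
    (hmax : ∀ β ∈ S, gap β ≤ gap α) {x y κ δ : ℝ} (hκ : 0 < κ) (hκ1 : κ ≤ 1)
    (hx : |x - α| * (200 * w ^ 2) ≤ gap α) (hxy : 19 / 20 * gap α ≤ |x - y|)
    (hxy' : |x - y| ≤ 41 / 20 * gap α) (hxS : ∀ β ∈ S, β ≠ α → κ ≤ approxRatio x β)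
    (hyS : ∀ β ∈ S, κ ≤ approxRatio y β) (hδ : 0 < δ) :
    ∃ p q : ℚ, p ≠ q ∧ |x - p| < δ ∧ |y - q| < δ ∧
      ∀ γ ∈ S, γ ≠ α → κ / (4 * w) / (130 * w ^ 2) ≤ crossRatio p q γ := by
  have hw := H.pos
  have hw2 : 1 ≤ w ^ 2 := one_le_pow₀ H.one_le
  have hd := H.gap_pos hα
  have hη : 0 < min δ (gap α / (200 * w ^ 2)) := by positivity
  obtain ⟨p, hxp, hp⟩ := exists_rat_abs_sub_le_one_div_sq x hη
  obtain ⟨q, hyq, hq⟩ := exists_rat_abs_sub_le_one_div_sq y hη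
  rw [lt_min_iff] at hxp hyq
  have hsmall : gap α / (200 * w ^ 2) ≤ gap α / 200 := by gcongr; linarith
  have hpα : |p - α| * (100 * w ^ 2) ≤ gap α := by
    have h := hxp.2.le
    rw [le_div_iff₀ (by positivity), abs_sub_comm] at h
    nlinarith [abs_sub_le (p : ℝ) x α]
  have hpq : 9 / 10 * gap α ≤ |(p : ℝ) - q| := by
    linarith [abs_sub_le x p y, abs_sub_le (p : ℝ) q y, abs_sub_comm y (q : ℝ)]
  have hpq' : |(p : ℝ) - q| ≤ 21 / 10 * gap α := by
    linarith [abs_sub_le (p : ℝ) x q, abs_sub_le x y q, abs_sub_comm x (p : ℝ)]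
  refine ⟨p, q, ?_, hxp.1, hyq.1, fun γ hγ hne ↦ ?_⟩
  · rintro rfl
    rw [sub_self, abs_zero] at hpq
    linarith
  · exact H.div_le_crossRatio hα hmax (by positivity) hpα hpq hpq' hγ hne
      (H.le_approxRatio_of_abs_sub_le hγ hκ hκ1 (hxS γ hγ hne) hp)
      (H.le_approxRatio_of_abs_sub_le (H.galConj_mem γ hγ) hκ hκ1
        (hyS _ (H.galConj_mem γ hγ)) hq)

theorem exists_rat_pair_crossRatio (H : OrbitSystem w S) (hc : 0 < c)
    (hcw : c * (10 ^ 7 * w ^ 5) ≤ 1) (hε : 0 < ε) :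
    ∃ p q : ℚ, p ≠ q ∧ (∀ γ ∈ S, c - ε ≤ crossRatio p q γ) ∧
      ∃ α ∈ S, |crossRatio p q α - c| < ε := by
  obtain ⟨α, hα, hlt, hmax⟩ := H.exists_maximal_gap
  have hw2 : 1 ≤ w ^ 2 := one_le_pow₀ H.one_le
  have hw := H.pos
  have hd := H.gap_pos hα
  have hcw2 : c * (10 ^ 7 * w ^ 2) ≤ 1 :=
    (by gcongr; exacts [H.one_le, by norm_num] : _ ≤ c * (10 ^ 7 * w ^ 5)).trans hcw
  have hc1 : c * 10 ^ 7 ≤ 1 := by nlinarith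
  have hκ1 : 1 / (16000 * w ^ 2) ≤ 1 := by rw [div_le_one (by positivity)]; linarith
  obtain ⟨x, y, hy, hy', hx, hx', hval, hxS, hyS⟩ := H.exists_pair_crossRatio hα hlt hmax hc
    (by linarith) (one_div_mul_cancel (a := 16000 * w ^ 2) (by positivity)).le
  have hcd : c * gap α * 10 ^ 7 ≤ gap α := by nlinarith
  have hlt' : x < y := by linarith
  have habs : |x - y| = y - x := by rw [abs_sub_comm, abs_of_pos (sub_pos.2 hlt')]
  obtain ⟨δ, hδ, hcont⟩ := Metric.continuousAt_iff.1 (H.continuousAt_crossRatio hα hlt'.ne) ε hε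
  obtain ⟨p, q, hpq, hxp, hyq, hlow⟩ := H.exists_rat_near_forall_le_crossRatio hα hmax
    (by positivity) hκ1 (x := x) (y := y) (by rw [abs_of_pos (sub_pos.2 hx)]; nlinarith)
    (by linarith) (by linarith) hxS hyS hδ
  have hnear : |crossRatio p q α - c| < ε := by
    rw [← hval]
    refine hcont (x := ((p : ℝ), (q : ℝ))) ?_
    rw [dist_comm, Prod.dist_eq]
    exact max_lt hxp hyq
  refine ⟨p, q, hpq, fun γ hγ ↦ ?_, α, hα, hnear⟩
  obtain rfl | hne := eq_or_ne γ α
  · linarith [(abs_lt.1 hnear).1]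
  · have hconst : c ≤ 1 / (16000 * w ^ 2) / (4 * w) / (130 * w ^ 2) := by
      rw [div_div, div_div, le_div_iff₀ (by positivity)]
      have : 0 ≤ c * w ^ 5 := by positivity
      linarith
    linarith [hlow γ hγ hne]

theorem exists_rat_approxRatio (H : OrbitSystem w S) (hc : 0 < c)
    (hcw : c * (10 ^ 7 * w ^ 5) ≤ 1) (hε : 0 < ε) :
    ∃ t : ℚ, (∀ β ∈ S, c - ε ≤ approxRatio t β) ∧ ∃ β ∈ S, |approxRatio t β - c| < ε := by
  obtain ⟨p, q, hpq, hlow, α, hα, hnear⟩ := H.exists_rat_pair_crossRatio hc hcw hε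
  obtain ⟨g, hg⟩ := exists_denom_ratCast_eq_zero q
  obtain ⟨t, ht⟩ := exists_ratCast_eq_moebius g p
  have hpq' : (p : ℝ) ≠ q := Rat.cast_injective.ne hpq
  refine ⟨t, fun β hβ ↦ ?_, moebius g α, H.moebius_mem g α hα, ?_⟩
  · obtain ⟨γ, hγ, rfl⟩ := H.exists_moebius_eq g hβ
    rw [← ht, H.approxRatio_moebius_of_pole hγ hg hpq']
    exact hlow γ hγ
  · rwa [← ht, H.approxRatio_moebius_of_pole hα hg hpq']

end OrbitSystem

/-! ### Approximation constants near a rational number -/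

theorem tendsto_add_mul_div_add_mul_atTop (a b c : ℝ) {d : ℝ} (hd : d ≠ 0) :
    Tendsto (fun x ↦ (a + c * x) / (b + d * x)) atTop (𝓝 (c / d)) := by
  have hlim (u v : ℝ) : Tendsto (fun x : ℝ ↦ u / x + v) atTop (𝓝 v) := by
    simpa using (tendsto_id.const_div_atTop u).add_const v
  refine ((hlim a c).div (hlim b d) hd).congr' ?_
  filter_upwards [eventually_ne_atTop 0] with x hx
  simp only [Pi.div_apply]
  field_simp

theorem tendsto_moebius_add_intCast {g : SL(2, ℤ)} (hg : (g.1 1 0 : ℝ) ≠ 0) (x : ℝ) :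
    Tendsto (fun K : ℤ ↦ moebius g (x + K)) atTop (𝓝 (g.1 0 0 / g.1 1 0)) := by
  have h := (tendsto_add_mul_div_add_mul_atTop (g.1 0 0 * x + g.1 0 1 : ℝ)
    (g.1 1 0 * x + g.1 1 1 : ℝ) (g.1 0 0 : ℝ) hg).comp tendsto_intCast_atTop_atTop
  refine h.congr fun K ↦ ?_
  rw [Function.comp_apply, moebius]
  ring_nf

theorem tendsto_abs_add_intCast_sub (a b : ℝ) :
    Tendsto (fun K : ℤ ↦ |a + K - b|) atTop atTop :=
  tendsto_abs_atTop_atTop.comp (tendsto_atTop_add_const_right _ (-b)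
    (tendsto_atTop_add_const_left _ a tendsto_intCast_atTop_atTop))

/-- `c` is, up to `ε`, the smallest value at `r` of the approximation ratio over the elements of `S`
of gap less than `δ`, for rational numbers `r` arbitrarily close to `r₀`; and this value is nearly
attained at elements of arbitrarily small gap. -/
def Approachable (S : Set ℝ) (c ε δ : ℝ) (r₀ : ℚ) : Prop :=
  ∀ ρ > 0, ∃ r : ℚ, |(r : ℝ) - r₀| < ρ ∧ (∀ β ∈ S, gap β < δ → c - ε ≤ approxRatio r β) ∧
    ∃ β ∈ S, gap β < ρ ∧ |approxRatio r β - c| < ε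

namespace OrbitSystem

variable {w : ℝ} {S : Set ℝ} {β τ : ℝ} {c e ε : ℝ}

theorem approxRatio_add_int (H : OrbitSystem w S) (hβ : β ∈ S) (x : ℝ) (n : ℤ) :
    approxRatio (x + n) (β + n) = approxRatio x β := by
  rw [approxRatio, H.gap_add_int hβ, add_sub_add_right_eq_sub, approxRatio]

theorem tendsto_gap_moebius_add_int (H : OrbitSystem w S) (hβ : β ∈ S) {g : SL(2, ℤ)} {y : ℚ}
    (hy : denom g y = 0) :
    Tendsto (fun K : ℤ ↦ gap (moebius g (β + K))) atTop (𝓝 0) := by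
  have hc : 0 < (g.1 1 0 : ℝ) ^ 2 := by have := coeff_ne_zero_of_pole hy; positivity
  refine (((tendsto_abs_add_intCast_sub β y).atTop_mul_atTop₀ (tendsto_abs_add_intCast_sub
    (galConj β) y)).const_mul_atTop hc).const_div_atTop (gap β) |>.congr fun K ↦ ?_
  rw [H.gap_moebius_of_pole (H.add_int_mem hβ K) hy, H.gap_add_int hβ, H.galConj_add_int hβ]

theorem tendsto_crossRatio_add_int (H : OrbitSystem w S) (hβ : β ∈ S) (x y : ℝ) :
    Tendsto (fun K : ℤ ↦ crossRatio (x + K) y (β + K)) atTop (𝓝 (approxRatio x β)) := by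
  have h := ((tendsto_add_mul_div_add_mul_atTop (galConj β - y) (x - y) 1
    one_ne_zero).comp tendsto_intCast_atTop_atTop).abs.const_mul (approxRatio x β)
  rw [div_one, abs_one, mul_one] at h
  refine h.congr fun K ↦ ?_
  rw [Function.comp_apply, crossRatio, H.gap_add_int hβ, H.galConj_add_int hβ,
    add_sub_add_right_eq_sub, approxRatio, abs_div, abs_sub_comm y, div_mul_div_comm, one_mul,
    add_sub_right_comm, add_sub_right_comm]
  ring_nf

theorem le_crossRatio_of_le_approxRatio (H : OrbitSystem w S) (hτ : τ ∈ S) {x y : ℝ} (hxy : x ≠ y)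
    (he : 0 < e) (hec : e ≤ c) (hx : c - e ≤ approxRatio x τ)
    (hfar : 2 * gap τ * c ≤ e * |x - y|) (hy : c ^ 2 / e * gap τ ≤ |y - galConj τ|) :
    c - 2 * e ≤ crossRatio x y τ := by
  rw [H.le_approxRatio_iff hτ] at hx
  rw [H.le_crossRatio_iff hτ hxy]
  rw [div_mul_eq_mul_div, div_le_iff₀ he] at hy
  have hc : 0 < c := he.trans_le hec
  have hg := H.gap_pos hτ
  have hTg : 0 < |x - y| * gap τ := mul_pos (abs_pos.2 (sub_ne_zero.2 hxy)) hg
  have htri : |x - y| ≤ |x - τ| + gap τ + |y - galConj τ| := by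
    rw [gap, abs_sub_comm y]
    linarith [abs_sub_le x τ y, abs_sub_le τ (galConj τ) y]
  rcases le_or_gt ((c - e) * |x - y|) (c * |y - galConj τ|) with hz | hz
  · refine le_of_mul_le_mul_left ?_ hc
    calc c * ((c - 2 * e) * (|x - y| * gap τ))
        ≤ (c - e) * gap τ * ((c - e) * |x - y|) := by nlinarith [mul_nonneg (sq_nonneg e) hTg.le]
      _ ≤ (c - e) * gap τ * (c * |y - galConj τ|) :=
          mul_le_mul_of_nonneg_left hz (mul_nonneg (sub_nonneg.2 hec) hg.le)
      _ ≤ 2 * |x - τ| * (c * |y - galConj τ|) := by gcongr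
      _ = c * (2 * (|x - τ| * |y - galConj τ|)) := by ring
  · have hxτ : e * |x - y| ≤ 2 * (c * |x - τ|) := by
      have := mul_le_mul_of_nonneg_left htri hc.le
      linarith
    refine le_of_mul_le_mul_left ?_ (mul_pos he hc)
    calc e * c * ((c - 2 * e) * (|x - y| * gap τ))
        ≤ e * |x - y| * (c ^ 2 * gap τ) := by nlinarith [mul_pos (mul_pos (mul_pos he he) hc) hTg]
      _ ≤ 2 * (c * |x - τ|) * (|y - galConj τ| * e) := by gcongr
      _ = e * c * (2 * (|x - τ| * |y - galConj τ|)) := by ring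

theorem mul_gap_le_of_gap_moebius_lt (H : OrbitSystem w S) (hτ : τ ∈ S) {g : SL(2, ℤ)} {y : ℚ}
    (hy : denom g y = 0) {M : ℝ} (hM : 0 < M)
    (hgap : gap (moebius g τ) * ((g.1 1 0 : ℝ) ^ 2 * ((M + 1) * M * w)) < 1) :
    M * gap τ ≤ |y - galConj τ| := by
  by_contra! hlt
  have hq := coeff_ne_zero_of_pole hy
  have hg := H.gap_pos hτ
  have hσ : 0 < |galConj τ - y| :=
    abs_pos.2 (sub_ne_zero.2 (H.ratCast_ne (H.galConj_mem τ hτ) y).symm)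
  have hτy : 0 < |τ - y| := abs_pos.2 (sub_ne_zero.2 (H.ratCast_ne hτ y).symm)
  rw [abs_sub_comm] at hlt
  have htri : |τ - y| ≤ (M + 1) * gap τ := by
    have := abs_sub_le τ (galConj τ) y
    rw [← gap] at this
    linarith
  refine hgap.not_ge ?_
  rw [H.gap_moebius_of_pole hτ hy, div_mul_eq_mul_div, one_le_div (by positivity)]
  calc (g.1 1 0 : ℝ) ^ 2 * (|τ - y| * |galConj τ - y|)
      ≤ (g.1 1 0 : ℝ) ^ 2 * ((M + 1) * gap τ * (M * gap τ)) := by gcongr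
    _ = gap τ * ((g.1 1 0 : ℝ) ^ 2 * ((M + 1) * M * gap τ)) := by ring
    _ ≤ gap τ * ((g.1 1 0 : ℝ) ^ 2 * ((M + 1) * M * w)) := by
        gcongr
        exact H.gap_le hτ

theorem exists_approachable (H : OrbitSystem w S) (hc : 0 < c) (hcw : c * (10 ^ 7 * w ^ 5) ≤ 1)
    (hε : 0 < ε) (r₀ : ℚ) : ∃ δ > 0, Approachable S c ε δ r₀ := by
  have hw := H.pos
  set e := min ε c / 2 with he
  have he0 : 0 < e := by positivity
  have heε : 2 * e ≤ ε := by linarith [min_le_left ε c]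
  have hec : e ≤ c := by linarith [min_le_right ε c]
  obtain ⟨t, ht, β, hβ, hβt⟩ := H.exists_rat_approxRatio hc hcw he0
  have hβt' : |approxRatio t β - c| < ε := by linarith
  obtain ⟨g, y, hy, hr₀⟩ := exists_pole_of_rat r₀
  have hq := coeff_ne_zero_of_pole hy
  have hM : 0 < c ^ 2 / e := by positivity
  refine ⟨1 / ((g.1 1 0 : ℝ) ^ 2 * ((c ^ 2 / e + 1) * (c ^ 2 / e) * w)), by positivity,
    fun ρ hρ ↦ ?_⟩
  obtain ⟨K, hKr₀, hKy, hKgap, hKc⟩ : ∃ K : ℤ, |moebius g (t + K) - r₀| < ρ ∧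
      2 * w * c / e + 1 ≤ |(t + K : ℝ) - y| ∧ gap (moebius g (β + K)) < ρ ∧
      |crossRatio (t + K) y (β + K) - c| < ε := by
    have hlim := tendsto_moebius_add_intCast hq t
    rw [hr₀] at hlim
    exact ((Metric.tendsto_nhds.1 hlim ρ hρ).and
      (((tendsto_abs_add_intCast_sub t y).eventually_ge_atTop _).and
      (((H.tendsto_gap_moebius_add_int hβ hy).eventually_lt_const hρ).and
      (((H.tendsto_crossRatio_add_int hβ t y).sub_const c).abs.eventually_lt_const
        hβt')))).exists
  have hpos : 0 ≤ 2 * w * c / e := by positivity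
  have hty : (t + K : ℝ) ≠ y := sub_ne_zero.1 (abs_pos.1 (by linarith))
  obtain ⟨r, hr⟩ := exists_ratCast_eq_moebius g (t + K)
  push_cast at hr
  refine ⟨r, hr ▸ hKr₀, fun β' hβ' hδ ↦ ?_, moebius g (β + K),
    H.moebius_mem g _ (H.add_int_mem hβ K), hKgap, ?_⟩
  · obtain ⟨τ, hτ, rfl⟩ := H.exists_moebius_eq g hβ'
    rw [← hr, H.approxRatio_moebius_of_pole hτ hy hty]
    rw [lt_div_iff₀ (by positivity)] at hδ
    have hlow : c - e ≤ approxRatio (t + K) τ := by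
      have h := H.approxRatio_add_int (H.add_int_mem hτ (-K)) t K
      rw [Int.cast_neg, neg_add_cancel_right] at h
      rw [h]
      exact ht _ (by simpa only [Int.cast_neg] using H.add_int_mem hτ (-K))
    have hfar : 2 * gap τ * c ≤ e * |(t + K : ℝ) - y| := calc
      2 * gap τ * c ≤ 2 * w * c := by gcongr; exact H.gap_le hτ
      _ = e * (2 * w * c / e) := by field_simp
      _ ≤ e * |(t + K : ℝ) - y| := by gcongr; linarith
    linarith [H.le_crossRatio_of_le_approxRatio hτ hty he0 hec hlow hfar
      (H.mul_gap_le_of_gap_moebius_lt hτ hy hM hδ)]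
  · rwa [← hr, H.approxRatio_moebius_of_pole (H.add_int_mem hβ K) hy hty]

theorem exists_approachable_of_nonneg (H : OrbitSystem w S) (hc : 0 ≤ c)
    (hcw : c * (10 ^ 7 * w ^ 5) ≤ 1) (hε : 0 < ε) (r₀ : ℚ) : ∃ δ > 0, Approachable S c ε δ r₀ := by
  have hw := H.pos
  set c' := max c (min (ε / 2) (1 / (10 ^ 7 * w ^ 5))) with hc'
  have hc'0 : 0 < c' := lt_max_of_lt_right (by positivity)
  have hcw' : c' * (10 ^ 7 * w ^ 5) ≤ 1 := by
    rw [← le_div_iff₀ (by positivity)] at hcw ⊢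
    exact max_le hcw (min_le_right _ _)
  have hle : c ≤ c' := le_max_left _ _
  have hle' : c' ≤ c + ε / 2 := max_le (by linarith) ((min_le_left _ _).trans (by linarith))
  obtain ⟨δ, hδ, happ⟩ := H.exists_approachable hc'0 hcw' (half_pos hε) r₀
  refine ⟨δ, hδ, fun ρ hρ ↦ ?_⟩
  obtain ⟨r, hr, hlow, β, hβ, hgap, hβc⟩ := happ ρ hρ
  refine ⟨r, hr, fun γ hγ hγδ ↦ ?_, β, hβ, hgap, ?_⟩
  · linarith [hlow γ hγ hγδ]
  · rw [abs_lt] at hβc ⊢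
    constructor <;> linarith

end OrbitSystem

/-! ### Realizing a given approximation constant -/

theorem exists_forall_abs_sub_le_two_mul {r ρ : ℕ → ℝ} (hr : ∀ k, |r (k + 1) - r k| ≤ ρ k)
    (hρ : ∀ k, ρ (k + 1) ≤ ρ k / 2) : ∃ ξ, ∀ k, |ξ - r k| ≤ 2 * ρ k := by
  have hmono : Monotone fun k ↦ r k - 2 * ρ k := monotone_nat_of_le_succ fun k ↦ by
    linarith [(abs_le.1 (hr k)).1, hρ k]
  have hanti : Antitone fun k ↦ r k + 2 * ρ k := antitone_nat_of_succ_le fun k ↦ by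
    linarith [(abs_le.1 (hr k)).2, hρ k]
  have hmem := hmono.ciSup_mem_iInter_Icc_of_antitone hanti fun k ↦ by
    linarith [(abs_nonneg _).trans (hr k)]
  rw [Set.mem_iInter] at hmem
  exact ⟨_, fun k ↦ abs_le.2 ⟨by linarith [(hmem k).1], by linarith [(hmem k).2]⟩⟩

theorem exists_succ_le_lt_of_tendsto {u : ℕ → ℝ} {a x : ℝ} (hu : Tendsto u atTop (𝓝 a))
    (hax : a < x) {k₀ : ℕ} (hx : x < u k₀) : ∃ k ≥ k₀, u (k + 1) ≤ x ∧ x < u k := by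
  by_contra! hcon
  have hlt : ∀ k ≥ k₀, x < u k := fun k hk ↦ by
    induction k, hk using Nat.le_induction with
    | base => exact hx
    | succ k hk ih => by_contra! h; exact (hcon k hk h).not_gt ih
  obtain ⟨k, hk, hkx⟩ := ((eventually_ge_atTop k₀).and (hu.eventually_lt_const hax)).exists
  exact (hlt k hk).not_gt hkx

theorem Approachable.mono {S : Set ℝ} {c ε δ δ' : ℝ} {r₀ : ℚ} (h : Approachable S c ε δ r₀)
    (hδ : δ' ≤ δ) : Approachable S c ε δ' r₀ := fun ρ hρ ↦
  (h ρ hρ).imp fun _ ⟨hr, hle, hex⟩ ↦ ⟨hr, fun β hβ hlt ↦ hle β hβ (hlt.trans_le hδ), hex⟩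

/-- `c` is the lower limit at `ξ` of the approximation ratio over the elements of `S` as their gap
tends to zero. -/
structure IsApproxConst (S : Set ℝ) (c ξ : ℝ) : Prop where
  exists_forall_le : ∀ ε > 0, ∃ δ > 0, ∀ β ∈ S, gap β < δ → c - ε ≤ approxRatio ξ β
  exists_abs_sub_lt : ∀ ε > 0, ∃ β ∈ S, gap β < ε ∧ |approxRatio ξ β - c| < ε

theorem IsApproxConst.of_forall {S : Set ℝ} (hS : ∀ β ∈ S, 0 < gap β) {c ξ : ℝ} {e Δ : ℕ → ℝ}
    (hΔ : ∀ k, 0 < Δ k) (he : Tendsto e atTop (𝓝 0)) (hΔ0 : Tendsto Δ atTop (𝓝 0))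
    (hle : ∀ k, ∀ β ∈ S, Δ (k + 1) ≤ gap β → gap β < Δ k → c - e k ≤ approxRatio ξ β)
    (hlt : ∀ k, ∃ β ∈ S, gap β < Δ k ∧ |approxRatio ξ β - c| < e k) : IsApproxConst S c ξ where
  exists_forall_le ε hε := by
    obtain ⟨k₀, hk₀⟩ := (he.eventually_lt_const hε).exists_forall_of_atTop
    refine ⟨Δ k₀, hΔ k₀, fun β hβ hβΔ ↦ ?_⟩
    obtain ⟨k, hk, hkβ, hβk⟩ := exists_succ_le_lt_of_tendsto hΔ0 (hS β hβ) hβΔ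
    linarith [hle k β hβ hkβ hβk, hk₀ k hk]
  exists_abs_sub_lt ε hε := by
    obtain ⟨k, hek, hΔk⟩ := ((he.eventually_lt_const hε).and (hΔ0.eventually_lt_const hε)).exists
    obtain ⟨β, hβ, hβΔ, hβc⟩ := hlt k
    exact ⟨β, hβ, hβΔ.trans hΔk, hβc.trans hek⟩

theorem tendsto_zero_of_succ_le_half {u : ℕ → ℝ} (hu : ∀ k, 0 ≤ u k)
    (hu' : ∀ k, u (k + 1) ≤ u k / 2) : Tendsto u atTop (𝓝 0) := by
  have hle (k : ℕ) : u k ≤ u 0 * (1 / 2) ^ k := by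
    induction k with
    | zero => simp
    | succ k ih => rw [pow_succ]; linarith [hu' k]
  have hlim := (tendsto_pow_atTop_nhds_zero_of_lt_one (r := (1 / 2 : ℝ)) (by norm_num)
    (by norm_num)).const_mul (u 0)
  exact squeeze_zero hu hle (by simpa using hlim)

namespace OrbitSystem

variable {w : ℝ} {S : Set ℝ} {c ξ : ℝ}

theorem exists_isApproxConst_of_seq (H : OrbitSystem w S) {e r Δ : ℕ → ℝ} (he : ∀ k, 0 < e k)
    (he' : ∀ k, e (k + 1) ≤ e k / 2) (hΔ : ∀ k, 0 < Δ k) (hΔ' : ∀ k, Δ (k + 1) ≤ Δ k / 2)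
    (hr : ∀ k, |r (k + 1) - r k| ≤ e k * Δ k)
    (hle : ∀ k, ∀ β ∈ S, gap β < Δ k → c - e k ≤ approxRatio (r (k + 1)) β)
    (hlt : ∀ k, ∃ β ∈ S, Δ (k + 1) ≤ gap β ∧ gap β < Δ k ∧
      |approxRatio (r (k + 1)) β - c| < e k) : ∃ ξ, IsApproxConst S c ξ := by
  obtain ⟨ξ, hξ⟩ := exists_forall_abs_sub_le_two_mul hr fun k ↦ by
    nlinarith [hΔ k, hΔ (k + 1), hΔ' k, he k, he (k + 1), he' k]
  have hpert (k : ℕ) (β : ℝ) (hβ : β ∈ S) (hβΔ : Δ (k + 1) ≤ gap β) :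
      |approxRatio ξ β - approxRatio (r (k + 1)) β| ≤ 2 * e k := by
    refine (abs_approxRatio_sub_le _ _ _).trans ((div_le_iff₀ (H.gap_pos hβ)).2 ?_)
    calc 2 * |ξ - r (k + 1)| ≤ 2 * (2 * (e (k + 1) * Δ (k + 1))) := by gcongr; exact hξ _
      _ ≤ 2 * (2 * (e k / 2 * gap β)) := by have := he k; have := hΔ (k + 1); gcongr; exact he' k
      _ = 2 * e k * gap β := by ring
  refine ⟨ξ, .of_forall (e := fun k ↦ 3 * e k) (fun β ↦ H.gap_pos) hΔ ?_
    (tendsto_zero_of_succ_le_half (fun k ↦ (hΔ k).le) hΔ') (fun k β hβ hΔβ hβΔ ↦ ?_) fun k ↦ ?_⟩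
  · simpa using (tendsto_zero_of_succ_le_half (fun k ↦ (he k).le) he').const_mul 3
  · linarith [hle k β hβ hβΔ, (abs_le.1 (hpert k β hβ hΔβ)).1]
  · obtain ⟨β, hβ, hΔβ, hβΔ, hβc⟩ := hlt k
    refine ⟨β, hβ, hβΔ, (abs_sub_le _ (approxRatio (r (k + 1)) β) _).trans_lt ?_⟩
    linarith [hpert k β hβ hΔβ]

theorem exists_isApproxConst (H : OrbitSystem w S) (hc : 0 ≤ c) (hcw : c * (10 ^ 7 * w ^ 5) ≤ 1) :
    ∃ ξ, IsApproxConst S c ξ := by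
  let e : ℕ → ℝ := fun k ↦ (1 / 2) ^ (k + 1)
  have he (k : ℕ) : 0 < e k := by positivity
  have he' (k : ℕ) : e k ≤ 1 / 2 := pow_le_of_le_one (by norm_num) (by norm_num) k.succ_ne_zero
  obtain ⟨δ₀, hδ₀, happ₀⟩ := H.exists_approachable_of_nonneg hc hcw (he 0) 0
  obtain ⟨u, -, hu⟩ := exists_seq_of_forall_exists
    (P := fun k (s : ℚ × ℝ) ↦ 0 < s.2 ∧ Approachable S c (e k) s.2 s.1)
    (R := fun k s s' ↦ |(s'.1 : ℝ) - s.1| ≤ e k * s.2 ∧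
      (∀ β ∈ S, gap β < s.2 → c - e k ≤ approxRatio s'.1 β) ∧
      s'.2 ≤ s.2 / 2 ∧ ∃ β ∈ S, s'.2 ≤ gap β ∧ gap β < s.2 ∧ |approxRatio s'.1 β - c| < e k)
    (x₀ := (0, δ₀)) ⟨hδ₀, happ₀⟩ <| by
      rintro k ⟨r, Δ⟩ ⟨hΔ, happ⟩
      obtain ⟨r', hr', hle, β, hβ, hβΔ, hβc⟩ := happ (e k * Δ) (mul_pos (he k) hΔ)
      obtain ⟨δ, hδ, happ'⟩ := H.exists_approachable_of_nonneg hc hcw (he (k + 1)) r'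
      have hhalf : gap β < Δ / 2 := by nlinarith [he' k]
      exact ⟨(r', min δ (gap β)), ⟨lt_min hδ (H.gap_pos hβ), happ'.mono (min_le_left _ _)⟩, hr'.le,
        hle, (min_le_right _ _).trans hhalf.le, β, hβ, min_le_right _ _, by linarith, hβc⟩
  exact H.exists_isApproxConst_of_seq (e := e) (r := fun k ↦ (u k).1) (Δ := fun k ↦ (u k).2) he
    (fun k ↦ (by simp only [e, pow_succ]; linarith)) (fun k ↦ (hu k).1.1)
    (fun k ↦ (hu k).2.2.2.1) (fun k ↦ (hu k).2.1) (fun k ↦ (hu k).2.2.1)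
    fun k ↦ (hu k).2.2.2.2

end OrbitSystem

namespace IsApproxConst

variable {w α c ξ : ℝ} {S : Set ℝ}

theorem irrational (h : IsApproxConst S c ξ) (H : OrbitSystem w S) (hc : c ≤ 1) :
    Irrational ξ := by
  rintro ⟨q, rfl⟩
  have hw := H.pos
  obtain ⟨β, hβ, hgap, hratio⟩ :=
    h.exists_abs_sub_lt (min (1 / 2) (1 / (2 * w * q.den ^ 2))) (by positivity)
  obtain ⟨-, hgap⟩ := lt_min_iff.1 hgap
  have hratio : approxRatio q β < 2 := by
    linarith [(abs_lt.1 (lt_min_iff.1 hratio).1).2]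
  have hlt : |q - β| < gap β := by linarith [(H.approxRatio_lt_iff hβ).1 hratio]
  have hcon := H.one_le_mul_abs_sub_of_lt_gap hβ hlt
  rw [← div_le_iff₀' (by positivity)] at hcon
  linarith

theorem notMem (h : IsApproxConst S c ξ) (H : OrbitSystem w S) (hc : c * (10 * w ^ 2) ≤ 1) :
    ξ ∉ S := by
  intro hξ
  have hw2 : 1 ≤ w ^ 2 := one_le_pow₀ H.one_le
  have hgapξ := H.gap_pos hξ
  obtain ⟨β, hβ, hgap, hratio⟩ :=
    h.exists_abs_sub_lt (min (gap ξ) (1 / (10 * w ^ 2))) (by positivity)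
  obtain ⟨hgap, -⟩ := lt_min_iff.1 hgap
  have hgapβ := H.gap_pos hβ
  have hnear : 10 * w ^ 2 * |ξ - β| < gap β := by
    have hratio' : approxRatio ξ β < 2 / (10 * w ^ 2) := by
      rw [← le_div_iff₀ (by positivity)] at hc
      have := (abs_lt.1 (lt_min_iff.1 hratio).2).2
      rw [← one_add_one_eq_two, add_div]
      linarith
    rw [H.approxRatio_lt_iff hβ, div_mul_eq_mul_div, lt_div_iff₀ (by positivity)] at hratio'
    linarith
  have hle : |ξ - β| ≤ gap β := by nlinarith [abs_nonneg (ξ - β)]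
  have hne : ξ ≠ β := by rintro rfl; exact hgap.false
  have hconj : |galConj ξ - galConj β| ≤ 3 * gap ξ := by linarith [abs_galConj_sub_le ξ β]
  refine (mul_pos hgapξ hgapβ).not_ge (le_of_mul_le_mul_left ?_ (two_pos (α := ℝ)))
  suffices 5 * (gap ξ * gap β) ≤ 3 * (gap ξ * gap β) by linarith
  calc 5 * (gap ξ * gap β)
      ≤ 5 * (2 * w ^ 2 * (|ξ - β| * |galConj ξ - galConj β|)) := by
        gcongr 5 * ?_; exact H.separation hξ hβ hne
    _ ≤ 5 * (2 * w ^ 2 * (|ξ - β| * (3 * gap ξ))) := by gcongr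
    _ = 10 * w ^ 2 * |ξ - β| * (3 * gap ξ) := by ring
    _ ≤ gap β * (3 * gap ξ) := by gcongr
    _ = 3 * (gap ξ * gap β) := by ring

theorem approxConst_eq (h : IsApproxConst (Theta α) c ξ) : approxConst α ξ = c := by
  have hbasis := (Metric.nhds_basis_ball (x := (0 : ℝ))).comap gap |>.inf_principal (Theta α)
  have hball (β ε : ℝ) : β ∈ gap ⁻¹' Metric.ball 0 ε ↔ gap β < ε := by
    rw [Set.mem_preimage, mem_ball_zero_iff, gap, norm_abs_eq_norm, Real.norm_eq_abs]
  change liminf (fun β ↦ (approxRatio ξ β : EReal)) (comap gap (𝓝 0) ⊓ 𝓟 (Theta α)) = c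
  apply le_antisymm
  · refine EReal.le_of_forall_lt_iff_le.1 fun z hz ↦ liminf_le_of_frequently_le' ?_
    rw [EReal.coe_lt_coe_iff] at hz
    refine hbasis.frequently_iff.2 fun {_} hε ↦ ?_
    obtain ⟨β, hβ, hgap, hratio⟩ := h.exists_abs_sub_lt _ (lt_min hε (sub_pos.2 hz))
    rw [lt_min_iff] at hgap hratio
    exact ⟨β, ⟨(hball _ _).2 hgap.1, hβ⟩,
      EReal.coe_le_coe_iff.2 (by linarith [(abs_lt.1 hratio.2).2])⟩
  · refine EReal.ge_of_forall_gt_iff_ge.1 fun z hz ↦ le_liminf_of_le (by isBoundedDefault) ?_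
    rw [EReal.coe_lt_coe_iff] at hz
    obtain ⟨δ, hδ, hle⟩ := h.exists_forall_le _ (sub_pos.2 hz)
    refine hbasis.eventually_iff.2 ⟨δ, hδ, fun β hβ ↦ EReal.coe_le_coe_iff.2 ?_⟩
    linarith [hle β hβ.2 ((hball _ _).1 hβ.1)]

end IsApproxConst

theorem ConjPair.Icc_subset_Sp {w α : ℝ} (h : ConjPair w α (galConj α)) (hα : Irrational α) :
    Set.Icc 0 (1 / (10 ^ 7 * w ^ 5)) ⊆ Sp α := by
  rintro c ⟨hc, hcw⟩
  have H := orbitSystem_Theta hα h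
  have hw := H.one_le
  rw [le_div_iff₀ (by positivity)] at hcw
  have hle : c * (10 * w ^ 2) ≤ 1 := by
    refine le_trans ?_ hcw
    gcongr <;> norm_num
  have hc1 : c ≤ 1 := by nlinarith [one_le_pow₀ hw (n := 2)]
  obtain ⟨ξ, hξ⟩ := H.exists_isApproxConst hc hcw
  exact ⟨ξ, hξ.irrational H hc1, hξ.notMem H hle, hξ.approxConst_eq⟩

/-! ### Continued fractions of quadratic irrationals -/

section CompleteQuotients

variable {w x : ℝ}

theorem completeQuot_add (x : ℝ) (k m : ℕ) :
    completeQuot x (k + m) = completeQuot (completeQuot x k) m := by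
  rw [completeQuot, completeQuot, completeQuot, add_comm, Function.iterate_add_apply]

theorem partialQuot_add (x : ℝ) (k m : ℕ) :
    partialQuot x (k + m) = partialQuot (completeQuot x k) m := by
  rw [partialQuot, partialQuot, completeQuot_add]

theorem completeQuot_succ (x : ℝ) (k : ℕ) :
    completeQuot x (k + 1) = (completeQuot x k - partialQuot x k)⁻¹ :=
  completeQuot_add x k 1

theorem completeQuot_eq_add_inv (x : ℝ) (k : ℕ) :
    completeQuot x k = partialQuot x k + (completeQuot x (k + 1))⁻¹ := by
  rw [completeQuot_succ, inv_inv, add_sub_cancel]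

theorem irrational_completeQuot (hx : Irrational x) (k : ℕ) : Irrational (completeQuot x k) := by
  induction k with
  | zero => exact hx
  | succ k ih =>
    rw [completeQuot_succ]
    exact (ih.sub_intCast _).inv

theorem one_lt_completeQuot_succ (hx : Irrational x) (k : ℕ) : 1 < completeQuot x (k + 1) := by
  have hne := (irrational_completeQuot hx k).ne_int (partialQuot x k)
  rw [completeQuot_succ]
  exact (one_lt_inv₀ (sub_pos.2 ((Int.floor_le _).lt_of_ne hne.symm))).2 (Int.fract_lt_one _)

theorem one_le_partialQuot_succ (hx : Irrational x) (k : ℕ) : 1 ≤ partialQuot x (k + 1) :=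
  Int.le_floor.2 (by exact_mod_cast (one_lt_completeQuot_succ hx k).le)

theorem convergent_eq_of_partialQuot_eq {x y : ℝ} (h : ∀ k, partialQuot x k = partialQuot y k)
    (n : ℕ) : x.convergent n = y.convergent n := by
  have hfloor : ⌊x⌋ = ⌊y⌋ := h 0
  induction n generalizing x y with
  | zero => rw [Real.convergent_zero, Real.convergent_zero, hfloor]
  | succ n ih =>
    rw [Real.convergent_succ, Real.convergent_succ, hfloor]
    rw [ih (x := (Int.fract x)⁻¹) (y := (Int.fract y)⁻¹) (fun k ↦ h (k + 1)) (h 1)]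

theorem eq_of_partialQuot_eq {x y : ℝ} (h : ∀ k, partialQuot x k = partialQuot y k) : x = y := by
  have hx := GenContFract.of_convergence x
  rw [funext fun n ↦ (Real.convs_eq_convergent x n).trans
    ((congr_arg _ (convergent_eq_of_partialQuot_eq h n)).trans
      (Real.convs_eq_convergent y n).symm)] at hx
  exact tendsto_nhds_unique hx (GenContFract.of_convergence y)

theorem ConjPair.inv_sub_intCast {y : ℝ} (h : ConjPair w x y) (hx : Irrational x) (n : ℤ) :
    ConjPair w (x - n)⁻¹ (y - n)⁻¹ := by
  have hpair := h.add_int (-n)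
  rw [Int.cast_neg, neg_add_eq_sub, neg_add_eq_sub] at hpair
  exact hpair.inv (sub_ne_zero.2 (hx.ne_int n)) (sub_ne_zero.2 ((h.irrational_right hx).ne_int n))

theorem ConjPair.map_completeQuot (h : ConjPair w x (galConj x)) (hx : Irrational x) (k : ℕ) :
    ConjPair w (completeQuot x k) (galConj (completeQuot x k)) := by
  induction k with
  | zero => exact h
  | succ k ih =>
    have hsucc := ih.inv_sub_intCast (irrational_completeQuot hx k) (partialQuot x k)
    rw [← completeQuot_succ] at hsucc
    rwa [hsucc.galConj_eq (irrational_completeQuot hx _)]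

theorem ConjPair.of_completeQuot (hx : Irrational x) (k : ℕ)
    (h : ConjPair w (completeQuot x k) (galConj (completeQuot x k))) :
    ConjPair w x (galConj x) := by
  induction k with
  | zero => exact h
  | succ k ih =>
    have hirr := irrational_completeQuot hx (k + 1)
    have hpair := (h.inv hirr.ne_zero (h.irrational_right hirr).ne_zero).add_int (partialQuot x k)
    rw [← completeQuot_eq_add_inv] at hpair
    exact ih (by rwa [hpair.galConj_eq (irrational_completeQuot hx k)])

theorem galConj_completeQuot_succ (h : ConjPair w x (galConj x)) (hx : Irrational x) (k : ℕ) :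
    galConj (completeQuot x (k + 1)) = (galConj (completeQuot x k) - partialQuot x k)⁻¹ := by
  have hsucc := (h.map_completeQuot hx k).inv_sub_intCast (irrational_completeQuot hx k)
    (partialQuot x k)
  rw [← completeQuot_succ] at hsucc
  exact hsucc.galConj_eq (irrational_completeQuot hx _)

theorem galConj_completeQuot_succ_neg_iff (h : ConjPair w x (galConj x)) (hx : Irrational x)
    (k : ℕ) :
    galConj (completeQuot x (k + 1)) < 0 ↔ galConj (completeQuot x k) < partialQuot x k := by
  rw [galConj_completeQuot_succ h hx, inv_neg'', sub_neg]

theorem exists_floor_galConj_completeQuot_ne (h : ConjPair w x (galConj x)) (hx : Irrational x) :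
    ∃ k, ⌊galConj (completeQuot x k)⌋ ≠ partialQuot x k := by
  by_contra! hall
  have hcomm (k : ℕ) : completeQuot (galConj x) k = galConj (completeQuot x k) := by
    induction k with
    | zero => rfl
    | succ k ih => rw [galConj_completeQuot_succ h hx, completeQuot_succ, partialQuot, ih, hall]
  exact h.ne (eq_of_partialQuot_eq fun k ↦ by rw [← hall, partialQuot, hcomm])

theorem exists_galConj_completeQuot_succ_neg (h : ConjPair w x (galConj x)) (hx : Irrational x) :
    ∃ k, galConj (completeQuot x (k + 1)) < 0 := by
  obtain ⟨k, hk⟩ := exists_floor_galConj_completeQuot_ne h hx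
  rcases hk.lt_or_gt with hlt | hgt
  · exact ⟨k, (galConj_completeQuot_succ_neg_iff h hx k).2 (Int.floor_lt.1 hlt)⟩
  · have hge : (partialQuot x k : ℝ) + 1 ≤ galConj (completeQuot x k) := by
      exact_mod_cast Int.le_floor.1 (Int.add_one_le_of_lt hgt)
    have hone : galConj (completeQuot x (k + 1)) ≤ 1 := by
      rw [galConj_completeQuot_succ h hx]
      exact inv_le_one_of_one_le₀ (by linarith)
    have hirr := (h.map_completeQuot hx (k + 1)).irrational_right (irrational_completeQuot hx _)
    refine ⟨k + 1, (galConj_completeQuot_succ_neg_iff h hx _).2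
      ((hone.lt_of_ne hirr.ne_one).trans_le ?_)⟩
    exact_mod_cast one_le_partialQuot_succ hx k

theorem exists_forall_galConj_completeQuot_neg (h : ConjPair w x (galConj x))
    (hx : Irrational x) : ∃ N, ∀ k ≥ N, galConj (completeQuot x (k + 1)) < 0 := by
  obtain ⟨N, hN⟩ := exists_galConj_completeQuot_succ_neg h hx
  refine ⟨N, fun k hk ↦ ?_⟩
  induction k, hk using Nat.le_induction with
  | base => exact hN
  | succ k _ ih =>
    have hpos : (1 : ℝ) ≤ partialQuot x (k + 1) := by exact_mod_cast one_le_partialQuot_succ hx k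
    exact (galConj_completeQuot_succ_neg_iff h hx _).2 (by linarith)

theorem finite_setOf_conjPair_pos_neg (w : ℝ) :
    {x : ℝ | ∃ y, 0 < x ∧ y < 0 ∧ ConjPair w x y}.Finite := by
  have hfin : {a : ℤ | |(a : ℝ)| ≤ w ^ 2}.Finite :=
    (Set.finite_Icc ⌈-w ^ 2⌉ ⌊w ^ 2⌋).subset fun a ha ↦
      ⟨Int.ceil_le.2 (abs_le.1 ha).1, Int.le_floor.2 (abs_le.1 ha).2⟩
  refine ((hfin.prod hfin).image fun p : ℤ × ℤ ↦ (w + p.2) / (2 * p.1)).subset ?_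
  rintro x ⟨y, hx, hy, hw, a, b, c, h1, h2, h3⟩
  have ha : (a : ℝ) ≠ 0 := left_ne_zero_of_mul (h1 ▸ hw.ne')
  have hc : (c : ℝ) ≠ 0 := h3 ▸ mul_ne_zero ha (mul_ne_zero hx.ne' hy.ne)
  have hac : (a * c : ℝ) < 0 := by
    rw [← h3, ← mul_assoc, ← sq]
    exact mul_neg_of_pos_of_neg (by positivity) (mul_neg_of_pos_of_neg hx hy)
  have hdisc : (b : ℝ) ^ 2 + 4 * |(a : ℝ) * c| = w ^ 2 := by
    rw [abs_of_neg hac, ← h1, ← h2]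
    linear_combination 4 * (a : ℝ) * h3
  have hale : |(a : ℝ)| ≤ |(a : ℝ) * c| := by
    rw [abs_mul]
    exact le_mul_of_one_le_right (abs_nonneg _) (one_le_abs_intCast hc)
  have hble : |(b : ℝ)| ≤ b ^ 2 := by
    rw [← Int.cast_abs, ← sq_abs, ← Int.cast_abs]
    exact_mod_cast Int.le_self_sq _
  refine ⟨(a, b), ⟨?_, ?_⟩, ?_⟩
  · change |(a : ℝ)| ≤ w ^ 2
    linarith [sq_nonneg (b : ℝ), abs_nonneg (a : ℝ)]
  · change |(b : ℝ)| ≤ w ^ 2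
    linarith [abs_nonneg (a * c : ℝ)]
  · simp only
    rw [← h1, ← h2]
    field_simp
    ring

theorem exists_periodicFrom (h : ConjPair w x (galConj x)) (hx : Irrational x) :
    ∃ s, 0 < s ∧ ∃ N, PeriodicFrom x N s := by
  obtain ⟨N, hN⟩ := exists_forall_galConj_completeQuot_neg h hx
  have hmaps : Set.MapsTo (fun k ↦ completeQuot x (N + k + 1)) Set.univ
      {z | ∃ y, 0 < z ∧ y < 0 ∧ ConjPair w z y} := fun k _ ↦
    ⟨_, one_pos.trans (one_lt_completeQuot_succ hx _), hN _ (Nat.le_add_right _ _),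
      h.map_completeQuot hx _⟩
  obtain ⟨i, -, j, -, hne, heq⟩ := Set.infinite_univ.exists_ne_map_eq_of_mapsTo hmaps
    (finite_setOf_conjPair_pos_neg w)
  wlog hlt : i < j generalizing i j
  · exact this j i hne.symm heq.symm (by omega)
  refine ⟨j - i, by omega, N + i + 1, fun k hk ↦ ?_⟩
  obtain ⟨l, rfl⟩ := Nat.exists_eq_add_of_le hk
  rw [show N + i + 1 + l + (j - i) = N + j + 1 + l by omega, partialQuot_add, partialQuot_add]
  exact congr_arg (partialQuot · l) heq.symm

theorem completeQuot_add_eq_of_periodicFrom {N s k : ℕ} (h : PeriodicFrom x N s) (hk : N ≤ k) :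
    completeQuot x (k + s) = completeQuot x k := by
  refine eq_of_partialQuot_eq fun m ↦ ?_
  rw [← partialQuot_add, ← partialQuot_add, add_right_comm, h _ (by omega)]

end CompleteQuotients

section Period

variable {w x : ℝ} {s : ℕ} {K : ℤ}

theorem exists_mul_completeQuot_eq (hx : Irrational x) (hs : 1 ≤ s)
    (hK : ∀ k < s, 1 ≤ partialQuot x k ∧ partialQuot x k + 1 ≤ K) :
    ∃ p q r t : ℤ, 0 ≤ p ∧ 0 ≤ q ∧ 0 < r ∧ 0 ≤ t ∧ p + q ≤ K ^ s ∧ r + t ≤ K ^ s ∧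
      x * (r * completeQuot x s + t) = p * completeQuot x s + q := by
  have hne (k : ℕ) : completeQuot x (k + 1) ≠ 0 := (irrational_completeQuot hx _).ne_zero
  induction s, hs using Nat.le_induction with
  | base =>
    obtain ⟨h1, h2⟩ := hK 0 one_pos
    refine ⟨partialQuot x 0, 1, 1, 0, by omega, by omega, one_pos, le_rfl,
      by rw [pow_one]; omega, by rw [pow_one]; omega, ?_⟩
    have hx0 : x = partialQuot x 0 + (completeQuot x 1)⁻¹ := completeQuot_eq_add_inv x 0
    have := hne 0
    push_cast
    nth_rw 1 [hx0]
    field_simp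
    ring
  | succ s _ ih =>
    obtain ⟨p, q, r, t, hp, hq, hr, ht, hpq, hrt, heq⟩ := ih fun k hk ↦ hK k (by omega)
    obtain ⟨h1, h2⟩ := hK s s.lt_succ_self
    refine ⟨p * partialQuot x s + q, p, r * partialQuot x s + t, r, by positivity, hp,
      by positivity, hr.le, ?_, ?_, ?_⟩
    · rw [pow_succ]; nlinarith
    · rw [pow_succ]; nlinarith
    · have := hne s
      rw [completeQuot_eq_add_inv x s] at heq
      push_cast
      field_simp at heq
      linear_combination heq

theorem exists_conjPair_of_completeQuot_eq (hx : Irrational x) (hs : 1 ≤ s)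
    (hK : ∀ k < s, 1 ≤ partialQuot x k ∧ partialQuot x k + 1 ≤ K) (hper : completeQuot x s = x) :
    ∃ w, ConjPair w x (galConj x) ∧ w ^ 2 ≤ 5 * (K : ℝ) ^ (2 * s) := by
  obtain ⟨p, q, r, t, hp, hq, hr, ht, hpq, hrt, heq⟩ := exists_mul_completeQuot_eq hx hs hK
  rw [hper] at heq
  refine ⟨_, ConjPair.of_root hx hr.ne' (b := p - t) (c := -q) ?_, ?_⟩
  · push_cast; linear_combination heq
  have hdisc : (((p - t : ℤ) : ℝ) ^ 2 - 4 * r * ((-q : ℤ) : ℝ)) =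
      (((p - t) ^ 2 + 4 * (r * q) : ℤ) : ℝ) := by push_cast; ring
  have hdisc0 : 0 ≤ (p - t) ^ 2 + 4 * (r * q) := by positivity
  rw [hdisc, Real.sq_sqrt (by exact_mod_cast hdisc0)]
  have hle : (p - t) ^ 2 + 4 * (r * q) ≤ 5 * (K ^ s * K ^ s) := by
    have hrq : r * q ≤ K ^ s * K ^ s := mul_le_mul (by linarith) (by linarith) hq (by linarith)
    have hpt : (p - t) ^ 2 ≤ (K ^ s) ^ 2 := sq_le_sq' (by linarith) (by linarith)
    linarith
  rw [two_mul, pow_add]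
  exact_mod_cast hle

theorem periodLength_pos_and_exists (h : ConjPair w x (galConj x)) (hx : Irrational x) :
    0 < periodLength x ∧ ∃ N, PeriodicFrom x N (periodLength x) :=
  Nat.sInf_mem (exists_periodicFrom h hx)

theorem periodicFrom_preperiodLength (h : ConjPair w x (galConj x)) (hx : Irrational x) :
    PeriodicFrom x (preperiodLength x) (periodLength x) :=
  Nat.sInf_mem (periodLength_pos_and_exists h hx).2

theorem partialQuot_add_two_le_periodBound {i : ℕ} (hi : i < periodLength x) :
    partialQuot x (preperiodLength x + i) + 2 ≤ periodBound x := by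
  have hle := Finset.le_sup (f := fun i ↦ (partialQuot x (preperiodLength x + i)).toNat)
    (Finset.mem_range.2 hi)
  rw [periodBound]
  omega

theorem partialQuot_period_bounds (h : ConjPair w x (galConj x)) (hx : Irrational x) {i : ℕ}
    (hi : i < periodLength x) :
    1 ≤ partialQuot x (preperiodLength x + periodLength x + i) ∧
      partialQuot x (preperiodLength x + periodLength x + i) + 2 ≤ periodBound x := by
  constructor
  · rw [show preperiodLength x + periodLength x + i =
      preperiodLength x + (periodLength x - 1) + i + 1 by omega]
    exact one_le_partialQuot_succ hx _
  · rw [add_right_comm, periodicFrom_preperiodLength h hx _ (Nat.le_add_right _ _)]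
    exact partialQuot_add_two_le_periodBound hi

theorem three_le_periodBound (h : ConjPair w x (galConj x)) (hx : Irrational x) :
    3 ≤ periodBound x := by
  have := partialQuot_period_bounds h hx (periodLength_pos_and_exists h hx).1
  omega

theorem exists_conjPair_sq_le (h : ConjPair w x (galConj x)) (hx : Irrational x) :
    ∃ w', ConjPair w' x (galConj x) ∧ w' ^ 2 ≤ (periodBound x : ℝ) ^ (2 * periodLength x + 2) := by
  obtain ⟨w', hpair, hw'⟩ := exists_conjPair_of_completeQuot_eq (K := periodBound x)
    (irrational_completeQuot hx (preperiodLength x + periodLength x))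
    (periodLength_pos_and_exists h hx).1
    (fun i hi ↦ by
      have := partialQuot_period_bounds h hx hi
      rw [← partialQuot_add]
      omega)
    (by
      rw [← completeQuot_add]
      exact completeQuot_add_eq_of_periodicFrom (periodicFrom_preperiodLength h hx)
        (Nat.le_add_right _ _))
  refine ⟨w', hpair.of_completeQuot hx _, hw'.trans ?_⟩
  have hB : (3 : ℝ) ≤ periodBound x := by exact_mod_cast three_le_periodBound h hx
  rw [pow_add, mul_comm, Int.cast_natCast]
  gcongr
  nlinarith

end Period

theorem lt_two_pow_minExp {s B : ℕ} (hs : 0 < s) :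
    16 * 16 * 36 * 144 * B ^ (2 * s + 8) < 2 ^ ((minExp s B - 1) * s) := by
  have hne : {n : ℕ | 0 < n ∧
      16 * 16 * 36 * 144 * B ^ (2 * s + 8) < 2 ^ ((n - 1) * s)}.Nonempty := by
    refine ⟨16 * 16 * 36 * 144 * B ^ (2 * s + 8) + 1, Nat.succ_pos _, ?_⟩
    rw [Nat.add_sub_cancel]
    exact Nat.lt_two_pow_self.trans_le
      (Nat.pow_le_pow_right two_pos (Nat.le_mul_of_pos_right _ hs))
  exact (Nat.sInf_mem hne).2

theorem psi_pos (x : ℝ) : 0 < psi x := by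
  have : 0 < periodBound x := by rw [periodBound]; omega
  rw [psi]
  positivity

theorem psi_le {w x : ℝ} (hs : 0 < periodLength x) (hw : 1 ≤ w)
    (hwB : w ^ 2 ≤ (periodBound x : ℝ) ^ (2 * periodLength x + 2)) :
    psi x ≤ 1 / (10 ^ 7 * w ^ 5) := by
  have hlt := lt_two_pow_minExp (B := periodBound x) hs
  have hB : (2 : ℝ) ≤ periodBound x := by exact_mod_cast (Nat.le_add_right 2 _)
  rw [psi]
  generalize periodLength x = s at *
  generalize periodBound x = B at *
  generalize minExp s B = n at *
  have hcube : (16 * 16 * 36 * 144 * w ^ 2) ^ 3 ≤ (B : ℝ) ^ (s * (6 * n + 6) + 4) := calc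
    (16 * 16 * 36 * 144 * w ^ 2) ^ 3
        ≤ (16 * 16 * 36 * 144 * (B : ℝ) ^ (2 * s + 8)) ^ 3 := by
      gcongr
      exact hwB.trans (pow_le_pow_right₀ (by linarith) (by omega))
    _ ≤ ((2 : ℝ) ^ ((n - 1) * s)) ^ 3 := by gcongr; exact_mod_cast hlt.le
    _ ≤ ((B : ℝ) ^ ((n - 1) * s)) ^ 3 := by gcongr
    _ = (B : ℝ) ^ ((n - 1) * s * 3) := (pow_mul _ _ _).symm
    _ ≤ (B : ℝ) ^ (s * (6 * n + 6) + 4) := by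
      refine pow_le_pow_right₀ (by linarith) ?_
      have : (n - 1) * s ≤ n * s := Nat.mul_le_mul_right s (n.sub_le 1)
      nlinarith
  refine one_div_le_one_div_of_le (by positivity) ?_
  calc 10 ^ 7 * w ^ 5 ≤ (16 * 16 * 36 * 144) ^ 3 * w ^ 6 := by gcongr <;> norm_num
    _ = (16 * 16 * 36 * 144 * w ^ 2) ^ 3 := by ring
    _ ≤ 72 * 72 * (B : ℝ) ^ (s * (6 * n + 6) + 4) :=
      hcube.trans (le_mul_of_one_le_left (by positivity) (by norm_num))

end QuadLagrange

end

theorem theorem1 (α : ℝ) (hα : QuadLagrange.IsRealQuadratic α) :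
    0 < QuadLagrange.psi α ∧
      Set.Icc (0 : ℝ) (QuadLagrange.psi α) ⊆ QuadLagrange.Sp α := by
  obtain ⟨_, h₀⟩ := hα.exists_conjPair
  obtain ⟨w, hpair, hw⟩ := QuadLagrange.exists_conjPair_sq_le h₀ hα.irrational
  have hs := (QuadLagrange.periodLength_pos_and_exists h₀ hα.irrational).1
  have hpsi := QuadLagrange.psi_le hs hpair.one_le hw
  exact ⟨QuadLagrange.psi_pos α,
    (Set.Icc_subset_Icc_right hpsi).trans (hpair.Icc_subset_Sp hα.irrational)⟩
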